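/- Let $1\le d\le n$ and let $\mathrm{Gr}(d,n)$ be the Grassmannian of unoriented $d$-planes in $\mathbb R^n$. Let $\Psi\in C^1(\mathrm{Gr}(d,n),(0,\infty))$. A rectifiable $d$-current with real coefficients is $A=(E,\theta\,\omega_P)$, where $E\subset\mathbb R^n$ is countably $d$-rectifiable and $\mathcal H^d$-measurable, $P$ is an $\mathcal H^d$-measurable orientation of the approximate tangent planes of $E$ with unit simple $d$-vector $\omega_P$, and $\theta\colon E\to[0,\infty)$ is an $\mathcal H^d$-measurable multiplicity with finite mass $\int_E\theta\,d\mathcal H^d<\infty$. It acts on smooth compactly supported $d$-forms by $A(\tau)=\int_E\theta\langle\tau,\omega_P\rangle\,d\mathcal H^d$, and $\partial A(\eta)=A(d\eta)$. Writing $p(P)\in\mathrm{Gr}(d,n)$ for the plane $P$ without its orientation, put $$F(A)=\int_E\theta(x)\,\Psi(p(P(x)))\,d\mathcal H^d(x),\qquad \mathcal V(A)=(\mathcal H^d\llcorner E)\otimes\theta\,\delta_{p(P(x))},$$ the latter being the varifold (positive Radon measure on $\mathbb R^n\times\mathrm{Gr}(d,n)$) associated with $A$. For an integral $(d-1)$-current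 $S$ in $\mathbb R^n$ let $\mathrm{FE}_F(S;\mathbb R)=\inf F(A)$, the infimum being over all rectifiable $d$-currents $A$ with real coefficients and $\partial A=S$. For a varifold $V$ let $F(V)=\int\Psi(T)\,dV(x,T)$, and for a smooth compactly supported vector field $g$ on $\mathbb R^n$ let $$\delta_\Psi[V](g)=\frac{d}{d\varepsilon}\Big|_{\varepsilon=0}F\big((\mathrm{id}+\varepsilon g)_\sharp V\big),$$ where, for a diffeomorphism $f$, the varifold $f_\sharp V$ is given by $\int\varphi\,d(f_\sharp V)=\int\varphi(f(x),d_xf(T))\,Jf(x,T)\,dV(x,T)$ for all $\varphi\in C_c(\mathbb R^n\times\mathrm{Gr}(d,n))$, and $Jf(x,T)$ is the $d$-dimensional Jacobian of $d_xf|_T$. **Proposition 4.1.** Let $S$ be an integral $(d-1)$-current in $\mathbb R^n$ and let $(A^j)_{j\in\mathbb N}$ be a sequence of rectifiable $d$-currents with real coefficients such that $$\partial A^j=S\ \text{ for all } j\qquad\text{and}\qquad \lim_{j\to\infty}F(A^j)=\mathrm{FE}_F(S;\mathbb R).$$ Suppose that the varifolds $\mathcal V(A^j)$ converge, weakly-$*$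 as Radon measures, to a varifold $W$. Then $W$ is $\Psi$-stationary away from $\operatorname{supp}S$: for every smooth vector field $g$ compactly supported in $\mathbb R^n\setminus\operatorname{supp}S$, the energies $F((\mathrm{id}+\varepsilon g)_\sharp W)$ are finite for $\varepsilon$ near $0$, the derivative $\delta_\Psi[W](g)$ exists, and $\delta_\Psi[W](g)=0$. -/

import Mathlib

open MeasureTheory Set Filter Topology
open scoped Distributions NNReal ENNReal

noncomputable section

namespace Aniso

/-- Euclidean space `ℝⁿ`. -/
abbrev Eucl (n : ℕ) : Type := EuclideanSpace ℝ (Fin n)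

/-! ### Grassmannians -/

/-- The Grassmannian `Gr(d,n)` of unoriented `d`-dimensional linear subspaces of `ℝⁿ`. -/
def Gr (d n : ℕ) : Type := {T : Submodule ℝ (Eucl n) // Module.finrank ℝ T = d}

/-- The usual topology of `Gr(d,n)`: a plane is identified with the orthogonal projection
onto it. -/
instance (d n : ℕ) : TopologicalSpace (Gr d n) :=
  TopologicalSpace.induced (fun T => T.1.starProjection) inferInstance

instance (d n : ℕ) : MeasurableSpace (Gr d n) := borel _

instance (d n : ℕ) : BorelSpace (Gr d n) := ⟨rfl⟩

/-- The oriented Grassmannian, as the set of unit simple `d`-vectors of `ℝⁿ`. (The sign matters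
only for `d = 0`, where the two orientations of the `0`-plane are `1` and `-1`.) -/
def OrientedGr (d n : ℕ) : Type :=
  {w : ⋀[ℝ]^d (Eucl n) // ∃ v : Fin d → Eucl n, Orthonormal ℝ v ∧
    (w = exteriorPower.ιMulti ℝ d v ∨ w = -exteriorPower.ιMulti ℝ d v)}

instance (d n : ℕ) : TopologicalSpace (OrientedGr d n) := instTopologicalSpaceSubtype

instance (d n : ℕ) : TopologicalSpace.PseudoMetrizableSpace (OrientedGr d n) :=
  inferInstanceAs (TopologicalSpace.PseudoMetrizableSpace {_w : ⋀[ℝ]^d (Eucl n) // _})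

instance (d n : ℕ) : SecondCountableTopology (OrientedGr d n) :=
  haveI : ProperSpace (⋀[ℝ]^d (Eucl n)) := FiniteDimensional.proper_real _
  inferInstanceAs (SecondCountableTopology {_w : ⋀[ℝ]^d (Eucl n) // _})

instance (d n : ℕ) : MeasurableSpace (OrientedGr d n) := borel _

instance (d n : ℕ) : BorelSpace (OrientedGr d n) := ⟨rfl⟩

/-- The linear subspace `{x : x ∧ w = 0}` determined by a `d`-vector `w`. -/
def spaceOf {d n : ℕ} (w : ⋀[ℝ]^d (Eucl n)) : Submodule ℝ (Eucl n) :=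
  LinearMap.ker ((LinearMap.mulRight ℝ (w : ExteriorAlgebra ℝ (Eucl n))).comp
    (ExteriorAlgebra.ι ℝ))

lemma spaceOf_ιMulti {d n : ℕ} {v : Fin d → Eucl n} (hv : LinearIndependent ℝ v) :
    spaceOf (exteriorPower.ιMulti ℝ d v) = Submodule.span ℝ (range v) := by
  ext x
  have key : (ExteriorAlgebra.ι ℝ x) *
      ((exteriorPower.ιMulti ℝ d v : ⋀[ℝ]^d (Eucl n)) : ExteriorAlgebra ℝ (Eucl n)) =
      ((exteriorPower.ιMulti ℝ (d + 1) (Fin.cons x v : Fin (d + 1) → Eucl n) :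
        ⋀[ℝ]^(d + 1) (Eucl n)) : ExteriorAlgebra ℝ (Eucl n)) := by
    rw [exteriorPower.ιMulti_apply_coe, exteriorPower.ιMulti_apply_coe,
      ExteriorAlgebra.ιMulti_succ_apply]
    simp [Matrix.vecTail, Function.comp_def]
  have h0 : exteriorPower.ιMulti ℝ (d + 1) (Fin.cons x v : Fin (d + 1) → Eucl n) = 0 ↔
      ¬ LinearIndependent ℝ (Fin.cons x v : Fin (d + 1) → Eucl n) := by
    constructor
    · intro h hli
      have h1 := exteriorPower.inner_ιMulti_self (Fin.cons x v : Fin (d + 1) → Eucl n)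
      rw [h, inner_zero_left] at h1
      exact (Matrix.det_gram_ne_zero_iff_linearIndependent (𝕜 := ℝ)).2 hli h1.symm
    · intro h
      exact AlternatingMap.map_linearDependent _ _ h
  rw [spaceOf, LinearMap.mem_ker]
  simp only [LinearMap.comp_apply, LinearMap.mulRight_apply]
  rw [key, Submodule.coe_eq_zero, h0, linearIndependent_finCons]
  simp [hv]

lemma spaceOf_neg {d n : ℕ} (w : ⋀[ℝ]^d (Eucl n)) : spaceOf (-w) = spaceOf w := by
  ext x
  simp [spaceOf]

lemma finrank_spaceOf {d n : ℕ} (P : OrientedGr d n) :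
    Module.finrank ℝ (spaceOf P.1) = d := by
  obtain ⟨v, hv, h | h⟩ := P.2
  · rw [h, spaceOf_ιMulti hv.linearIndependent,
      finrank_span_eq_card hv.linearIndependent, Fintype.card_fin]
  · rw [h, spaceOf_neg, spaceOf_ιMulti hv.linearIndependent,
      finrank_span_eq_card hv.linearIndependent, Fintype.card_fin]

/-- The map `p` from the oriented Grassmannian to the Grassmannian that forgets orientation. -/
def OrientedGr.forget {d n : ℕ} (P : OrientedGr d n) : Gr d n :=
  ⟨spaceOf P.1, finrank_spaceOf P⟩

/-! ### Integrands -/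

open Classical in
/-- A function on `Gr(d,n)` as a function of a (not necessarily orthonormal) frame, by evaluating
it at the span of the frame; the value off the set of linearly independent frames is
irrelevant. -/
def onFrames {d n : ℕ} (Ψ : Gr d n → ℝ) (v : Fin d → Eucl n) : ℝ :=
  if h : LinearIndependent ℝ v then
    Ψ ⟨Submodule.span ℝ (range v), by rw [finrank_span_eq_card h, Fintype.card_fin]⟩
  else 0

/-- `Ψ ∈ C¹(Gr(d,n), (0,∞))`. The smooth structure of `Gr(d,n)` is that of the quotient of the
open set of linearly independent frames under the submersion `v ↦ span v`, so `Ψ` is `C¹` iff its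
pull-back to frames is. -/
structure IsC1Integrand {d n : ℕ} (Ψ : Gr d n → ℝ) : Prop where
  pos : ∀ T, 0 < Ψ T
  contDiffOn : ContDiffOn ℝ 1 (onFrames Ψ) {v | LinearIndependent ℝ v}

/-! ### Currents -/

/-- Smooth compactly supported differential `m`-forms on `ℝⁿ`. -/
abbrev TestForm (m n : ℕ) : Type := 𝓓((⊤ : TopologicalSpace.Opens (Eucl n)), Eucl n [⋀^Fin m]→L[ℝ] ℝ)

/-- `m`-dimensional currents in `ℝⁿ`. -/
abbrev Current (m n : ℕ) : Type := TestForm m n →L[ℝ] ℝ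

/-- The exterior derivative on test forms. -/
def dTest (m n : ℕ) : TestForm m n →L[ℝ] TestForm (m + 1) n :=
  (TestFunction.postcompCLM
    (ContinuousAlternatingMap.alternatizeUncurryFinCLM ℝ (Eucl n) ℝ)).comp
    (TestFunction.fderivCLM ℝ ⊤ ⊤)

lemma dTest_apply {m n : ℕ} (τ : TestForm m n) (x : Eucl n) :
    dTest m n τ x = extDeriv (τ : Eucl n → Eucl n [⋀^Fin m]→L[ℝ] ℝ) x := by
  simp [dTest, extDeriv]

/-- The boundary of a current, `∂T(τ) = T(dτ)`. -/
def boundary {m n : ℕ} (T : Current (m + 1) n) : Current m n := T.comp (dTest m n)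

/-- The duality pairing of an `m`-covector with an `m`-vector. -/
def pairing {m n : ℕ} (τ : Eucl n [⋀^Fin m]→L[ℝ] ℝ) (w : ⋀[ℝ]^m (Eucl n)) : ℝ :=
  exteriorPower.alternatingMapLinearEquiv τ.toAlternatingMap w

lemma pairing_ιMulti {m n : ℕ} (τ : Eucl n [⋀^Fin m]→L[ℝ] ℝ) (v : Fin m → Eucl n) :
    pairing τ (exteriorPower.ιMulti ℝ m v) = τ v := by
  simp [pairing]

lemma continuous_pairing {m n : ℕ} :
    Continuous (fun p : (Eucl n [⋀^Fin m]→L[ℝ] ℝ) × ⋀[ℝ]^m (Eucl n) => pairing p.1 p.2) := by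
  let b := (EuclideanSpace.basisFun (Fin n) ℝ).toBasis.exteriorPower m
  have h : ∀ p : (Eucl n [⋀^Fin m]→L[ℝ] ℝ) × ⋀[ℝ]^m (Eucl n),
      pairing p.1 p.2 = ∑ s, b.repr p.2 s * pairing p.1 (b s) := by
    intro p
    have h1 := congrArg (pairing p.1) (b.sum_repr p.2)
    rw [← h1]
    simp only [pairing, map_sum, map_smul, smul_eq_mul]
  simp_rw [h]
  refine continuous_finsetSum _ fun s _ => Continuous.mul ?_ ?_
  · exact ((b.coord s).continuous_of_finiteDimensional).comp continuous_snd
  · simp only [b, exteriorPower.coe_basis, exteriorPower.ιMulti_family, pairing_ιMulti]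
    exact (ContinuousAlternatingMap.apply ℝ (Eucl n) ℝ _).continuous.comp continuous_fst

lemma abs_pairing_le {m n : ℕ} (τ : Eucl n [⋀^Fin m]→L[ℝ] ℝ) (P : OrientedGr m n) :
    ‖pairing τ P.1‖ ≤ ‖τ‖ := by
  obtain ⟨v, hv, h | h⟩ := P.2
  · rw [h, pairing_ιMulti]
    simpa [hv.1] using τ.le_opNorm v
  · have : pairing τ (-exteriorPower.ιMulti ℝ m v) = - τ v := by
      rw [← pairing_ιMulti]; simp [pairing]
    rw [h, this, norm_neg]
    simpa [hv.1] using τ.le_opNorm v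

/-! ### Rectifiable currents -/

/-- Countable `d`-rectifiability: up to an `ℋᵈ`-null set, `M` is covered by countably many
Lipschitz images of `ℝᵈ`. -/
def IsCountablyRectifiable {n : ℕ} (d : ℕ) (M : Set (Eucl n)) : Prop :=
  ∃ f : ℕ → Eucl d → Eucl n, (∀ i, ∃ K : ℝ≥0, LipschitzWith K (f i)) ∧
    μHE[d] (M \ ⋃ i, range (f i)) = 0

/-- The plane field `P` is `ℋᵈ`-almost everywhere on the (countably `d`-rectifiable) set `M` the
approximate tangent plane of `M`: in every Lipschitz parametrization `f : ℝᵈ → ℝⁿ`, for almost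
every `y` with `f y ∈ M` at which `Df(y)` exists and has rank `d`, the plane at `f y` is the image
of `Df(y)`. -/
def IsTangentField {d n : ℕ} (M : Set (Eucl n)) (P : Eucl n → Gr d n) : Prop :=
  ∀ f : Eucl d → Eucl n, (∃ K : ℝ≥0, LipschitzWith K f) →
    ∀ᵐ y, f y ∈ M → DifferentiableAt ℝ f y → Function.Injective (fderiv ℝ f y) →
      (P (f y)).1 = (fderiv ℝ f y).range

/-- A rectifiable `d`-current `(E, θ ω_P)` in `ℝⁿ` with real coefficients: an `ℋᵈ`-measurable,
countably `d`-rectifiable set `E`, an `ℋᵈ`-measurable orientation `P` of its (approximate) tangent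
planes, and an `ℋᵈ`-measurable multiplicity `θ ≥ 0` with finite total mass `∫_E θ dℋᵈ`. -/
structure RectifiableCurrent (d n : ℕ) where
  carrier : Set (Eucl n)
  orient : Eucl n → OrientedGr d n
  mult : Eucl n → ℝ≥0
  nullMeasurableSet_carrier : NullMeasurableSet carrier μHE[d]
  rectifiable : IsCountablyRectifiable d carrier
  aemeasurable_orient : AEMeasurable orient (μHE[d].restrict carrier)
  aemeasurable_mult : AEMeasurable mult (μHE[d].restrict carrier)
  mass_lt_top : ∫⁻ x in carrier, mult x ∂μHE[d] < ∞
  tangent : IsTangentField carrier (fun x => (orient x).forget)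

namespace RectifiableCurrent

variable {d n : ℕ}

/-- The mass measure `‖A‖ = θ ℋᵈ⌞E` of `A = (E, θ ω_P)`. -/
def massMeasure (A : RectifiableCurrent d n) : Measure (Eucl n) :=
  (μHE[d].restrict A.carrier).withDensity (fun x => (A.mult x : ℝ≥0∞))

instance (A : RectifiableCurrent d n) : IsFiniteMeasure A.massMeasure :=
  isFiniteMeasure_withDensity A.mass_lt_top.ne

lemma aestronglyMeasurable_pairing (A : RectifiableCurrent d n)
    {τ : Eucl n → Eucl n [⋀^Fin d]→L[ℝ] ℝ} (hτ : Continuous τ) :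
    AEStronglyMeasurable (fun x => pairing (τ x) (A.orient x).1) A.massMeasure := by
  have h0 : AEMeasurable A.orient A.massMeasure :=
    A.aemeasurable_orient.mono_ac (withDensity_absolutelyContinuous _ _)
  have h1 : AEStronglyMeasurable A.orient A.massMeasure := h0.aestronglyMeasurable
  have h2 : AEStronglyMeasurable (fun x => (A.orient x).1) A.massMeasure := by
    have h3 : Continuous (fun P : OrientedGr d n => P.1) := continuous_subtype_val
    exact h3.comp_aestronglyMeasurable h1
  have h4 : AEStronglyMeasurable τ A.massMeasure := hτ.aestronglyMeasurable
  have h5 := continuous_pairing.comp_aestronglyMeasurable (h4.prodMk h2)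
  exact h5

lemma integrable_pairing (A : RectifiableCurrent d n)
    (τ : BoundedContinuousFunction (Eucl n) (Eucl n [⋀^Fin d]→L[ℝ] ℝ)) :
    Integrable (fun x => pairing (τ x) (A.orient x).1) A.massMeasure :=
  Integrable.of_bound (A.aestronglyMeasurable_pairing τ.continuous) ‖τ‖
    (ae_of_all _ fun x => (abs_pairing_le _ _).trans (τ.norm_coe_le_norm x))

/-- Integration over `A` of bounded continuous forms. -/
def integrate (A : RectifiableCurrent d n) :
    BoundedContinuousFunction (Eucl n) (Eucl n [⋀^Fin d]→L[ℝ] ℝ) →L[ℝ] ℝ :=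
  LinearMap.mkContinuous
    { toFun := fun τ => ∫ x, pairing (τ x) (A.orient x).1 ∂A.massMeasure
      map_add' := fun f g => by
        rw [← integral_add (A.integrable_pairing f) (A.integrable_pairing g)]
        refine integral_congr_ae (ae_of_all _ fun x => ?_)
        simp [pairing]
      map_smul' := fun c f => by
        rw [← integral_smul]
        refine integral_congr_ae (ae_of_all _ fun x => ?_)
        simp [pairing] }
    (A.massMeasure.real univ)
    (fun f => by
      rw [mul_comm]
      exact norm_integral_le_of_norm_le_const
        (ae_of_all _ fun x => (abs_pairing_le _ _).trans (f.norm_coe_le_norm x)))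

/-- The current `A = (E, θ ω_P)`, acting on test forms by integration. -/
def toCurrent (A : RectifiableCurrent d n) : Current d n :=
  A.integrate.comp (TestFunction.toBoundedContinuousFunctionCLM ℝ)

lemma toCurrent_apply (A : RectifiableCurrent d n) (τ : TestForm d n) :
    A.toCurrent τ = ∫ x in A.carrier, A.mult x * pairing (τ x) (A.orient x).1 ∂μHE[d] := by
  have h : A.toCurrent τ = ∫ x, pairing (τ x) (A.orient x).1 ∂A.massMeasure := rfl
  rw [h, massMeasure, integral_withDensity_eq_integral_smul₀ A.aemeasurable_mult]
  rfl

/-- The anisotropic energy `F_Ψ(A) = ∫_E θ(x) Ψ(P(x)) dℋᵈ(x)`, for an even integrand, i.e. a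
function `Ψ` on the unoriented Grassmannian. -/
def energy (Ψ : Gr d n → ℝ) (A : RectifiableCurrent d n) : ℝ≥0∞ :=
  ∫⁻ x in A.carrier, A.mult x * ENNReal.ofReal (Ψ (A.orient x).forget) ∂μHE[d]

/-- The varifold `𝒱(A) = (ℋᵈ⌞E) ⊗ θ δ_{p(P(x))}` associated with `A`. -/
def toVarifold (A : RectifiableCurrent d n) : Measure (Eucl n × Gr d n) :=
  A.massMeasure.map (fun x => (x, (A.orient x).forget))

end RectifiableCurrent

/-- Integer multiplicity rectifiable currents. -/
def IsIntegerRectifiable {m n : ℕ} (T : Current m n) : Prop :=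
  ∃ R : RectifiableCurrent m n,
    (∀ᵐ x ∂(μHE[m].restrict R.carrier), ∃ k : ℕ, R.mult x = k) ∧ R.toCurrent = T

/-- Integral currents: integer multiplicity rectifiable currents whose boundary (in positive
dimension) is again integer multiplicity rectifiable. -/
def IsIntegralCurrent {n : ℕ} : {m : ℕ} → Current m n → Prop
  | 0, T => IsIntegerRectifiable T
  | _ + 1, T => IsIntegerRectifiable T ∧ IsIntegerRectifiable (boundary T)

/-- The filling energy `FE_F(S; ℝ)`: the infimum of `F_Ψ(A)` over all rectifiable currents `A` with
real coefficients and `∂A = S`. -/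
def fillingEnergy {k n : ℕ} (Ψ : Gr (k + 1) n → ℝ) (S : Current k n) : ℝ≥0∞ :=
  ⨅ (A : RectifiableCurrent (k + 1) n) (_ : boundary A.toCurrent = S), A.energy Ψ

/-! ### Varifolds

A `d`-dimensional varifold in `ℝⁿ` is a positive Radon measure on `ℝⁿ × Gr(d,n)`, i.e. a Borel
measure that is finite on compact sets. -/

/-- Convergence of varifolds: weak-* convergence as Radon measures. -/
def VarifoldTendsto {d n : ℕ} (V : ℕ → Measure (Eucl n × Gr d n))
    (W : Measure (Eucl n × Gr d n)) : Prop :=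
  ∀ φ : Eucl n × Gr d n → ℝ, Continuous φ → HasCompactSupport φ →
    Tendsto (fun j => ∫ p, φ p ∂(V j)) atTop (𝓝 (∫ p, φ p ∂W))

/-- The energy `F_Ψ(V) = ∫ Ψ(T) dV(x,T)` of a varifold. -/
def varifoldEnergy {d n : ℕ} (Ψ : Gr d n → ℝ) (V : Measure (Eucl n × Gr d n)) : ℝ≥0∞ :=
  ∫⁻ p, ENNReal.ofReal (Ψ p.2) ∂V

open Classical in
/-- The image of a `d`-plane under a linear map (with an irrelevant value if the image is not a
`d`-plane). -/
def Gr.map {d n : ℕ} (L : Eucl n →L[ℝ] Eucl n) (T : Gr d n) : Gr d n :=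
  if h : Module.finrank ℝ (T.1.map L.toLinearMap) = d then ⟨T.1.map L.toLinearMap, h⟩ else T

/-- The `d`-dimensional Jacobian of the linear map `L` restricted to the `d`-plane `T`. -/
def planeJacobian {d n : ℕ} (L : Eucl n →L[ℝ] Eucl n) (T : Gr d n) : ℝ :=
  (L.toLinearMap.comp T.1.subtype).normDet

/-- The image varifold `f_♯ V` under a diffeomorphism `f`:
`∫ φ d(f_♯ V) = ∫ φ(f(x), d_x f(T)) Jf(x,T) dV(x,T)`. -/
def varifoldImage {d n : ℕ} (f : Eucl n → Eucl n) (V : Measure (Eucl n × Gr d n)) :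
    Measure (Eucl n × Gr d n) :=
  (V.withDensity fun p => ENNReal.ofReal (planeJacobian (fderiv ℝ f p.1) p.2)).map
    fun p => (f p.1, Gr.map (fderiv ℝ f p.1) p.2)

/-- The first variation `δ_Ψ[V](g) = d/dε F_Ψ((id + ε g)_♯ V)` at `ε = 0` exists and equals `c`:
the energies are finite for `ε` near `0`, and differentiable in `ε` at `0` with derivative `c`. -/
def HasFirstVariation {d n : ℕ} (Ψ : Gr d n → ℝ) (V : Measure (Eucl n × Gr d n))
    (g : Eucl n → Eucl n) (c : ℝ) : Prop :=
  (∀ᶠ ε : ℝ in 𝓝 0, varifoldEnergy Ψ (varifoldImage (fun x => x + ε • g x) V) ≠ ∞) ∧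
    HasDerivAt (fun ε : ℝ =>
      (varifoldEnergy Ψ (varifoldImage (fun x => x + ε • g x) V)).toReal) c 0

/-- `V` is `Ψ`-stationary in the open set `U`: its first variation vanishes on all smooth vector
fields with compact support in `U`. -/
def IsStationaryIn {d n : ℕ} (Ψ : Gr d n → ℝ) (V : Measure (Eucl n × Gr d n))
    (U : Set (Eucl n)) : Prop :=
  ∀ g : Eucl n → Eucl n, ContDiff ℝ (⊤ : ℕ∞) g → HasCompactSupport g → tsupport g ⊆ U →
    HasFirstVariation Ψ V g 0

end Aniso

/-! Stationarity comes from comparing the minimizing sequence with its own deformations. Let `g` be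
supported off `supp S` and let `f = id + ε g` with `|ε| Lip(g) ≤ 1/2`, so that `f` is a bi-Lipschitz
diffeomorphism. Pushing `A j` forward by `f` gives a rectifiable current which still fills `S`,
because `f` is the identity off `supp g` (`LipDiffeo.boundary_push_eq`). Its energy is therefore at
least the filling energy. This energy is also the integral against the varifold of `A j` of the
fixed function `deformedDensity`, which is the Jacobian of `1 + ε Dg` on `T` times `Ψ` of the image
plane (`energy_push_eq_lintegral_toVarifold`).

The density minus `Ψ` is continuous with compact support, since it vanishes off `supp g` and the
Grassmannian is compact. Its integrals hence converge to the integral against `W`, while the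
integrals of `Ψ` converge to the filling energy. In the limit the filling energy cancels, and the
energy of the deformed `W` is at least that of `W` (`integral_le_integral_deformedDensity`). Mass of
the sequence may escape to infinity; this does no harm, as only the difference is passed to the
limit. The energy of the deformed `W` thus has a local minimum at `ε = 0`. It is differentiable
there by dominated convergence, the `C¹` integrand giving Lipschitz bounds uniform in the plane
(`exists_hasDerivAt_integral_deformedDensity`), so its derivative is `0`.

Most of the work goes into the push-forward. It must be a rectifiable current in its own right and
satisfy `(f_♯ A)(τ) = A(f^* τ)`. Both rest on the tangential change of variables
`LipDiffeo.restrict_image_eq`, which is deduced from an area formula for `ℋᵈ` on the pieces of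
Lipschitz parametrizations. -/

namespace Aniso

/-! ### The area formula -/

section HausdorffComparison

variable {X Y Z : Type*} [MetricSpace Y] [MeasurableSpace Y] [BorelSpace Y]
  [MetricSpace Z] [MeasurableSpace Z] [BorelSpace Z]

/-- Where `g` identifies two points of `s`, the hypothesis forces `f` to identify them too. So `f`
factors on `s` through `g` by a `c`-Lipschitz map `k`, and no injectivity is needed. It serves to
compare a nonlinear map with a linear model, in both directions. -/
lemma euclideanHausdorffMeasure_image_le_of_edist_le {d : ℕ} {f : X → Y} {g : X → Z} {c : ℝ≥0}
    {s : Set X} (h : ∀ x ∈ s, ∀ y ∈ s, edist (f x) (f y) ≤ c * edist (g x) (g y)) :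
    μHE[d] (f '' s) ≤ (c : ℝ≥0∞) ^ d * μHE[d] (g '' s) := by
  rcases s.eq_empty_or_nonempty with rfl | ⟨x₀, hx₀⟩
  · simp
  have : Nonempty X := ⟨x₀⟩
  set k : Z → Y := fun z => f (Function.invFunOn g s z)
  have hk : ∀ x ∈ s, k (g x) = f x := by
    intro x hx
    have h1 : Function.invFunOn g s (g x) ∈ s := Function.invFunOn_mem ⟨x, hx, rfl⟩
    have h2 : g (Function.invFunOn g s (g x)) = g x := Function.invFunOn_eq ⟨x, hx, rfl⟩
    have h3 := h _ h1 _ hx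
    rw [h2, edist_self, mul_zero] at h3
    exact edist_eq_zero.1 (le_antisymm h3 bot_le)
  have hkl : LipschitzOnWith c k (g '' s) := by
    rintro _ ⟨x, hx, rfl⟩ _ ⟨y, hy, rfl⟩
    rw [hk x hx, hk y hy]
    exact h x hx y hy
  have himg : f '' s = k '' (g '' s) := by
    rw [image_image]
    exact image_congr fun x hx => (hk x hx).symm
  have h4 := hkl.hausdorffMeasure_image_le (d := (d : ℝ)) (Nat.cast_nonneg d)
  rw [himg, Measure.euclideanHausdorffMeasure_def, Measure.euclideanHausdorffMeasure_def]
  simp only [Measure.smul_apply, ENNReal.smul_def, smul_eq_mul]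
  rw [ENNReal.rpow_natCast] at h4
  calc _ ≤ _ := mul_le_mul_right h4 _
    _ = _ := by ring

lemma _root_.LipschitzWith.euclideanHausdorffMeasure_image_le {d : ℕ} {f : Z → Y} {c : ℝ≥0}
    (hf : LipschitzWith c f) (s : Set Z) :
    μHE[d] (f '' s) ≤ (c : ℝ≥0∞) ^ d * μHE[d] s := by
  simpa using euclideanHausdorffMeasure_image_le_of_edist_le (d := d) (f := f) (g := id) (s := s)
    (fun x _ y _ => hf x y)

end HausdorffComparison

/-! ### Linear maps: distortion of distances and of volume. -/

section NormDet

variable {d : ℕ} {F : Type*} [NormedAddCommGroup F] [InnerProductSpace ℝ F]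

/-- A map which is close enough to an injective linear map `A` distorts distances as `A` does,
up to a factor `c > 1`. -/
lemma exists_approximatesLinearOn_comparable {c : ℝ≥0} (hc : 1 < c) {A : Eucl d →L[ℝ] F}
    (hA : Function.Injective A) :
    ∃ δ : ℝ≥0, δ ≠ 0 ∧ ∀ (v : Eucl d) (w : F), ‖w - A v‖ ≤ δ * ‖v‖ →
      ‖w‖ ≤ c * ‖A v‖ ∧ ‖A v‖ ≤ c * ‖w‖ := by
  obtain ⟨K, hK, hAK⟩ := (LinearMap.injective_iff_antilipschitz A.toLinearMap).1 hA
  have hAK' : ∀ v, ‖v‖ ≤ K * ‖A v‖ := fun v => hAK.le_mul_norm (map_zero _) v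
  have hc0 : (0 : ℝ) < c := lt_trans one_pos (by exact_mod_cast hc)
  have hc1 : (1 : ℝ) < c := by exact_mod_cast hc
  have hKpos : (0 : ℝ) < K := by exact_mod_cast hK
  -- A relative error `η` gives the factors `1 + η` and `1 / (1 - η)`. The second equals `c` for
  -- this `η`, and the first is at most `c` because `(c - 1)² / c ≥ 0`.
  set η : ℝ := 1 - 1 / c
  have hη : 0 < η := by
    have : 1 / (c : ℝ) < 1 := by rw [div_lt_one hc0]; exact hc1
    simp only [η]; linarith
  refine ⟨⟨η / K, by positivity⟩, ?_, fun v w hw => ?_⟩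
  · intro h0
    have : η / K = 0 := congrArg NNReal.toReal h0
    have : 0 < η / K := by positivity
    linarith
  · have h1 : ‖w - A v‖ ≤ η * ‖A v‖ := by
      refine hw.trans ?_
      change η / K * ‖v‖ ≤ _
      calc η / K * ‖v‖ ≤ η / K * (K * ‖A v‖) := by gcongr; exact hAK' v
        _ = η * ‖A v‖ := by field_simp
    have h2 : ‖w‖ ≤ ‖w - A v‖ + ‖A v‖ := by simpa using norm_add_le (w - A v) (A v)
    have h3 : ‖A v‖ ≤ ‖w - A v‖ + ‖w‖ := by
      simpa [norm_sub_rev] using norm_add_le (A v - w) w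
    have h4 : η + 1 ≤ c := by
      have : 0 ≤ ((c : ℝ) - 1) ^ 2 / c := by positivity
      have h5 : ((c : ℝ) - 1) ^ 2 / c = c - 1 - η := by simp only [η]; field_simp
      linarith
    have h6 : (1 - η) * c = 1 := by simp only [η]; field_simp; ring
    constructor
    · nlinarith [norm_nonneg (A v)]
    · have : (1 - η) * ‖A v‖ ≤ ‖w‖ := by linarith
      calc ‖A v‖ = c * ((1 - η) * ‖A v‖) := by rw [← mul_assoc, mul_comm (c : ℝ), h6, one_mul]
        _ ≤ c * ‖w‖ := by gcongr

/-- The square of `normDet` is the Gram determinant of the images of a fixed orthonormal basis,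
which is polynomial in `A`. -/
lemma continuous_normDet : Continuous fun A : Eucl d →L[ℝ] F => A.toLinearMap.normDet := by
  have h : ∀ A : Eucl d →L[ℝ] F, A.toLinearMap.normDet =
      √(Matrix.gram ℝ (fun i => A (EuclideanSpace.basisFun (Fin d) ℝ i))).det := by
    intro A
    rw [eq_comm, Real.sqrt_eq_iff_mul_self_eq]
    · have := A.toLinearMap.normDet_sq_eq_det_gram (EuclideanSpace.basisFun (Fin d) ℝ)
      rw [← pow_two]
      exact this.symm
    · have := A.toLinearMap.normDet_sq_eq_det_gram (EuclideanSpace.basisFun (Fin d) ℝ)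
      exact this ▸ sq_nonneg A.toLinearMap.normDet
    · exact A.toLinearMap.normDet_nonneg
  simp_rw [h]
  refine Real.continuous_sqrt.comp (Continuous.matrix_det ?_)
  refine continuous_matrix fun i j => ?_
  simp only [Matrix.gram_apply]
  fun_prop

end NormDet

section Area

variable {d : ℕ} {F G : Type*} [NormedAddCommGroup F] [InnerProductSpace ℝ F]
  [MeasurableSpace F] [BorelSpace F]
  [NormedAddCommGroup G] [InnerProductSpace ℝ G]
  [MeasurableSpace G] [BorelSpace G]

lemma euclideanHausdorffMeasure_linear_image (A : Eucl d →L[ℝ] F) (s : Set (Eucl d)) :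
    μHE[d] (A '' s) = ENNReal.ofReal A.toLinearMap.normDet * volume s := by
  have h := A.toLinearMap.hausdorffMeasure_image s
  rw [finrank_euclideanSpace_fin] at h
  rw [← EuclideanSpace.euclideanHausdorffMeasure_eq_volume d,
    Measure.euclideanHausdorffMeasure_def, Measure.euclideanHausdorffMeasure_def]
  simp only [Measure.smul_apply, ENNReal.smul_def, smul_eq_mul]
  rw [show (A '' s) = A.toLinearMap '' s from rfl, h]
  ring

/-- Both images of the unit ball have measure `normDet` times its volume, so the bound on measures
under a `c`-Lipschitz comparison gives the bound on determinants. The codomains may differ. -/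
lemma normDet_le_of_norm_le {A : Eucl d →L[ℝ] F} {B : Eucl d →L[ℝ] G} {c : ℝ≥0}
    (h : ∀ v, ‖B v‖ ≤ c * ‖A v‖) :
    ENNReal.ofReal B.toLinearMap.normDet ≤
      (c : ℝ≥0∞) ^ d * ENNReal.ofReal A.toLinearMap.normDet := by
  have h1 := euclideanHausdorffMeasure_image_le_of_edist_le (d := d) (f := B) (g := A) (c := c)
    (s := Metric.ball (0 : Eucl d) 1) (fun x _ y _ => by
      rw [edist_eq_enorm_sub, edist_eq_enorm_sub, ← map_sub, ← map_sub]
      have := h (x - y)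
      simp only [enorm_eq_nnnorm]
      exact_mod_cast this)
  rw [euclideanHausdorffMeasure_linear_image, euclideanHausdorffMeasure_linear_image,
    ← mul_assoc] at h1
  exact (ENNReal.mul_le_mul_iff_left (Metric.measure_ball_pos volume _ one_pos).ne'
    measure_ball_lt_top.ne).1 h1

end Area

/-! ### Derivatives of maps that are nearly linear on a set. -/

section

open scoped Pointwise Function
open Metric

/-- If a differentiable function `f` is approximated by a linear map `A` on a set `s`, up to `δ`,
then at almost every `x` in `s` one has `‖f' x - A‖ ≤ δ`. This extends
`ApproximatesLinearOn.norm_fderiv_sub_le` to maps between different spaces. -/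
theorem _root_.ApproximatesLinearOn.norm_hasFDerivWithinAt_sub_le {E F : Type*}
    [NormedAddCommGroup E] [NormedSpace ℝ E] [FiniteDimensional ℝ E] [MeasurableSpace E]
    [BorelSpace E] [NormedAddCommGroup F] [NormedSpace ℝ F] (μ : Measure E) [μ.IsAddHaarMeasure]
    {A : E →L[ℝ] F} {δ : ℝ≥0}
    {s : Set E} {f : E → F} (hf : ApproximatesLinearOn f A s δ) (hs : MeasurableSet s)
    (f' : E → E →L[ℝ] F)
    (hf' : ∀ x ∈ s, HasFDerivWithinAt f (f' x) s x) : ∀ᵐ x ∂μ.restrict s, ‖f' x - A‖₊ ≤ δ := by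
  filter_upwards [Besicovitch.ae_tendsto_measure_inter_div μ s, ae_restrict_mem hs]
  intro x hx xs
  apply ContinuousLinearMap.opNorm_le_bound _ δ.2 fun z => ?_
  suffices H : ∀ ε, 0 < ε → ‖(f' x - A) z‖ ≤ (δ + ε) * (‖z‖ + ε) + ‖f' x - A‖ * ε by
    have :
      Tendsto (fun ε : ℝ => ((δ : ℝ) + ε) * (‖z‖ + ε) + ‖f' x - A‖ * ε) (𝓝[>] 0)
        (𝓝 ((δ + 0) * (‖z‖ + 0) + ‖f' x - A‖ * 0)) :=
      Tendsto.mono_left (Continuous.tendsto (by fun_prop) 0) nhdsWithin_le_nhds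
    simp only [add_zero, mul_zero] at this
    apply le_of_tendsto_of_tendsto tendsto_const_nhds this
    filter_upwards [self_mem_nhdsWithin]
    exact H
  intro ε εpos
  -- At a density point `x`, the set `s` contains points `x + r a` with `a` within `ε` of the
  -- prescribed direction `z`. The approximation, known only on `s`, thus tests `f' x - A` in almost
  -- every direction.
  have B₁ : ∀ᶠ r in 𝓝[>] (0 : ℝ), (s ∩ ({x} + r • closedBall z ε)).Nonempty :=
    Measure.eventually_nonempty_inter_smul_of_density_one μ s x hx _ measurableSet_closedBall
      (measure_closedBall_pos μ z εpos).ne'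
  obtain ⟨ρ, ρpos, hρ⟩ :
    ∃ ρ > 0, ball x ρ ∩ s ⊆ {y : E | ‖f y - f x - (f' x) (y - x)‖ ≤ ε * ‖y - x‖} :=
    mem_nhdsWithin_iff.1 ((hf' x xs).isLittleO.def εpos)
  have B₂ : ∀ᶠ r in 𝓝[>] (0 : ℝ), {x} + r • closedBall z ε ⊆ ball x ρ := by
    apply nhdsWithin_le_nhds
    exact eventually_singleton_add_smul_subset isBounded_closedBall (ball_mem_nhds x ρpos)
  obtain ⟨r, ⟨y, ⟨ys, hy⟩⟩, rρ, rpos⟩ :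
    ∃ r : ℝ,
      (s ∩ ({x} + r • closedBall z ε)).Nonempty ∧ {x} + r • closedBall z ε ⊆ ball x ρ ∧ 0 < r :=
    (B₁.and (B₂.and self_mem_nhdsWithin)).exists
  obtain ⟨a, az, ya⟩ : ∃ a, a ∈ closedBall z ε ∧ y = x + r • a := by
    simp only [mem_smul_set, image_add_left, mem_preimage, singleton_add] at hy
    rcases hy with ⟨a, az, ha⟩
    exact ⟨a, az, by simp only [ha, add_neg_cancel_left]⟩
  have norm_a : ‖a‖ ≤ ‖z‖ + ε :=
    calc
      ‖a‖ = ‖z + (a - z)‖ := by simp only [add_sub_cancel]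
      _ ≤ ‖z‖ + ‖a - z‖ := norm_add_le _ _
      _ ≤ ‖z‖ + ε := by grw [mem_closedBall_iff_norm.1 az]
  have I : r * ‖(f' x - A) a‖ ≤ r * (δ + ε) * (‖z‖ + ε) :=
    calc
      r * ‖(f' x - A) a‖ = ‖(f' x - A) (r • a)‖ := by
        simp only [map_smul, norm_smul, Real.norm_eq_abs, abs_of_nonneg rpos.le]
      _ = ‖f y - f x - A (y - x) - (f y - f x - (f' x) (y - x))‖ := by
        simp only [ya, add_sub_cancel_left, sub_sub_sub_cancel_left, FunLike.coe_sub,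
          Pi.sub_apply, map_smul, smul_sub]
      _ ≤ ‖f y - f x - A (y - x)‖ + ‖f y - f x - (f' x) (y - x)‖ := norm_sub_le _ _
      _ ≤ δ * ‖y - x‖ + ε * ‖y - x‖ := (add_le_add (hf _ ys _ xs) (hρ ⟨rρ hy, ys⟩))
      _ = r * (δ + ε) * ‖a‖ := by
        simp only [ya, add_sub_cancel_left, norm_smul, Real.norm_eq_abs, abs_of_nonneg rpos.le]
        ring
      _ ≤ r * (δ + ε) * (‖z‖ + ε) := by gcongr
  calc
    ‖(f' x - A) z‖ = ‖(f' x - A) a + (f' x - A) (z - a)‖ := by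
      congr 1
      simp only [FunLike.coe_sub, map_sub, Pi.sub_apply]
      abel
    _ ≤ ‖(f' x - A) a‖ + ‖(f' x - A) (z - a)‖ := norm_add_le _ _
    _ ≤ (δ + ε) * (‖z‖ + ε) + ‖f' x - A‖ * ‖z - a‖ := by
      apply add_le_add
      · rw [mul_assoc] at I; exact (mul_le_mul_iff_right₀ rpos).1 I
      · apply ContinuousLinearMap.le_opNorm
    _ ≤ (δ + ε) * (‖z‖ + ε) + ‖f' x - A‖ * ε := by
      rw [mem_closedBall_iff_norm'] at az
      gcongr

end

/-! ### The area formula and the image of the critical set. -/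

section Area

open scoped Function

variable {d : ℕ} {F : Type*} [NormedAddCommGroup F] [InnerProductSpace ℝ F]
  [MeasurableSpace F] [BorelSpace F]

/-- Both quantities are compared with `normDet A * volume s`: the image measure through distances,
the integral through `‖f' x - A‖ ≤ δ` almost everywhere. Each comparison costs `c ^ d`. -/
lemma _root_.ApproximatesLinearOn.euclideanHausdorffMeasure_comparable {c δ : ℝ≥0}
    {A : Eucl d →L[ℝ] F}
    (hδ : ∀ (v : Eucl d) (w : F), ‖w - A v‖ ≤ δ * ‖v‖ → ‖w‖ ≤ c * ‖A v‖ ∧ ‖A v‖ ≤ c * ‖w‖)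
    {f : Eucl d → F} {f' : Eucl d → Eucl d →L[ℝ] F} {s : Set (Eucl d)} (hs : MeasurableSet s)
    (hf : ApproximatesLinearOn f A s δ) (hf' : ∀ x ∈ s, HasFDerivWithinAt f (f' x) s x) :
    μHE[d] (f '' s) ≤ (c : ℝ≥0∞) ^ (2 * d) *
        ∫⁻ x in s, ENNReal.ofReal (f' x).toLinearMap.normDet ∧
      ∫⁻ x in s, ENNReal.ofReal (f' x).toLinearMap.normDet ≤
        (c : ℝ≥0∞) ^ (2 * d) * μHE[d] (f '' s) := by
  have hdist : ∀ x ∈ s, ∀ y ∈ s, edist (f x) (f y) ≤ c * edist (A x) (A y) ∧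
      edist (A x) (A y) ≤ c * edist (f x) (f y) := by
    intro x hx y hy
    have h := hδ (x - y) (f x - f y) (hf x hx y hy)
    simp only [edist_eq_enorm_sub, ← map_sub, enorm_eq_nnnorm]
    exact ⟨by exact_mod_cast h.1, by exact_mod_cast h.2⟩
  have h1 : μHE[d] (f '' s) ≤
      (c : ℝ≥0∞) ^ d * (ENNReal.ofReal A.toLinearMap.normDet * volume s) := by
    rw [← euclideanHausdorffMeasure_linear_image]
    exact euclideanHausdorffMeasure_image_le_of_edist_le fun x hx y hy => (hdist x hx y hy).1
  have h2 : ENNReal.ofReal A.toLinearMap.normDet * volume s ≤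
      (c : ℝ≥0∞) ^ d * μHE[d] (f '' s) := by
    rw [← euclideanHausdorffMeasure_linear_image]
    exact euclideanHausdorffMeasure_image_le_of_edist_le fun x hx y hy => (hdist x hx y hy).2
  have h3 : ∀ᵐ x ∂volume.restrict s,
      ENNReal.ofReal A.toLinearMap.normDet ≤
        (c : ℝ≥0∞) ^ d * ENNReal.ofReal (f' x).toLinearMap.normDet ∧
      ENNReal.ofReal (f' x).toLinearMap.normDet ≤
        (c : ℝ≥0∞) ^ d * ENNReal.ofReal A.toLinearMap.normDet := by
    filter_upwards [hf.norm_hasFDerivWithinAt_sub_le volume hs f' hf'] with x hx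
    have h : ∀ v, ‖f' x v - A v‖ ≤ δ * ‖v‖ := fun v =>
      ((f' x - A).le_opNorm v).trans (by gcongr; exact_mod_cast hx)
    exact ⟨normDet_le_of_norm_le fun v => (hδ v _ (h v)).2,
      normDet_le_of_norm_le fun v => (hδ v _ (h v)).1⟩
  have hc : (c : ℝ≥0∞) ^ d ≠ ∞ := ENNReal.pow_ne_top ENNReal.coe_ne_top
  rw [two_mul, pow_add]
  constructor
  · rw [mul_assoc]
    refine h1.trans ?_
    refine mul_le_mul_right ?_ _
    rw [← lintegral_const_mul' _ _ hc, ← setLIntegral_const]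
    exact lintegral_mono_ae (h3.mono fun x hx => hx.1)
  · rw [mul_assoc]
    refine le_trans ?_ (mul_le_mul_right h2 _)
    rw [← setLIntegral_const, ← lintegral_const_mul' _ _ hc]
    exact lintegral_mono_ae (h3.mono fun x hx => hx.2)

/-- The area formula for an injective map with injective derivative. -/
theorem euclideanHausdorffMeasure_image_eq_lintegral_normDet [FiniteDimensional ℝ F]
    {f : Eucl d → F}
    {f' : Eucl d → Eucl d →L[ℝ] F} {s : Set (Eucl d)} (hs : MeasurableSet s)
    (hf' : ∀ x ∈ s, HasFDerivWithinAt f (f' x) s x)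
    (hinj' : ∀ x ∈ s, Function.Injective (f' x)) (hinj : InjOn f s) :
    μHE[d] (f '' s) = ∫⁻ x in s, ENNReal.ofReal (f' x).toLinearMap.normDet := by
  rcases s.eq_empty_or_nonempty with rfl | hne
  · simp
  have key : ∀ c : ℝ≥0, 1 < c →
      μHE[d] (f '' s) ≤ (c : ℝ≥0∞) ^ (2 * d) *
        ∫⁻ x in s, ENNReal.ofReal (f' x).toLinearMap.normDet ∧
      ∫⁻ x in s, ENNReal.ofReal (f' x).toLinearMap.normDet ≤
        (c : ℝ≥0∞) ^ (2 * d) * μHE[d] (f '' s) := by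
    intro c hc
    -- The partition lemma wants a tolerance for every `A`. The dummy value `1` for non-injective
    -- `A` plays no role, since the models it returns are derivatives at points of `s`.
    have hr : ∀ A : Eucl d →L[ℝ] F, ∃ δ : ℝ≥0, δ ≠ 0 ∧ (Function.Injective A →
        ∀ (v : Eucl d) (w : F), ‖w - A v‖ ≤ δ * ‖v‖ →
          ‖w‖ ≤ c * ‖A v‖ ∧ ‖A v‖ ≤ c * ‖w‖) := by
      intro A
      by_cases hA : Function.Injective A
      · obtain ⟨δ, h1, h2⟩ := exists_approximatesLinearOn_comparable hc hA
        exact ⟨δ, h1, fun _ => h2⟩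
      · exact ⟨1, one_ne_zero, fun h => absurd h hA⟩
    choose r hr0 hr using hr
    obtain ⟨t, A, hdisj, hmeas, hcov, happ, hA⟩ :=
      exists_partition_approximatesLinearOn_of_hasFDerivWithinAt f s f' hf' r hr0
    have hAinj : ∀ k, Function.Injective (A k) := by
      intro k
      obtain ⟨y, hy, h⟩ := hA hne k
      rw [h]
      exact hinj' y hy
    have hst : s = ⋃ k, s ∩ t k := by
      rw [← inter_iUnion, inter_eq_left.2 hcov]
    have hdisj' : Pairwise (Disjoint on fun k => s ∩ t k) := fun i j hij =>
      (hdisj hij).mono inter_subset_right inter_subset_right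
    have hpiece := fun k => (happ k).euclideanHausdorffMeasure_comparable (hr _ (hAinj k))
      (hs.inter (hmeas k)) (fun x hx => (hf' x hx.1).mono inter_subset_left)
    have hI : ∫⁻ x in s, ENNReal.ofReal (f' x).toLinearMap.normDet =
        ∑' k, ∫⁻ x in s ∩ t k, ENNReal.ofReal (f' x).toLinearMap.normDet := by
      conv_lhs => rw [hst]
      exact lintegral_iUnion (fun k => hs.inter (hmeas k)) hdisj' _
    -- Injectivity of `f` makes the images of the pieces disjoint and Borel, so their measures add
    -- up.
    have hH : μHE[d] (f '' s) = ∑' k, μHE[d] (f '' (s ∩ t k)) := by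
      conv_lhs => rw [hst, image_iUnion]
      refine measure_iUnion (fun i j hij => ?_) fun k => ?_
      · exact (hdisj' hij).image hinj inter_subset_left inter_subset_left
      · exact (hs.inter (hmeas k)).image_of_continuousOn_injOn
          (fun x hx => ((hf' x hx.1).mono inter_subset_left).continuousWithinAt)
          (hinj.mono inter_subset_left)
    rw [hI, hH, ← ENNReal.tsum_mul_left, ← ENNReal.tsum_mul_left]
    exact ⟨ENNReal.tsum_le_tsum fun k => (hpiece k).1,
      ENNReal.tsum_le_tsum fun k => (hpiece k).2⟩
  have hlim : ∀ a : ℝ≥0∞, Tendsto (fun c : ℝ≥0 => (c : ℝ≥0∞) ^ (2 * d) * a) (𝓝[>] 1) (𝓝 a) := by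
    intro a
    have h1 : Tendsto (fun c : ℝ≥0 => (c : ℝ≥0∞) ^ (2 * d)) (𝓝[>] 1) (𝓝 1) := by
      have h : Continuous fun c : ℝ≥0 => (c : ℝ≥0∞) ^ (2 * d) :=
        (ENNReal.continuous_pow _).comp ENNReal.continuous_coe
      have := (h.tendsto 1).mono_left (nhdsWithin_le_nhds (s := Ioi 1))
      simpa using this
    simpa using ENNReal.Tendsto.mul_const h1 (Or.inl one_ne_zero)
  exact le_antisymm
    (ge_of_tendsto (hlim _) (eventually_nhdsWithin_of_forall fun c hc => (key c hc).1))
    (ge_of_tendsto (hlim _) (eventually_nhdsWithin_of_forall fun c hc => (key c hc).2))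

/-- Replace `A` by `B ε v = (A v, ε v)`. Its `normDet` tends to that of `B 0`, which vanishes
because `A` is not injective. With tolerance `δ = ε`, `‖f x - f y‖ ≤ ‖A (x - y)‖ + ε ‖x - y‖ ≤ 2 ‖B
ε (x - y)‖`, so the image has measure at most `2 ^ d * normDet (B ε) * volume s`. -/
lemma exists_approximatesLinearOn_image_le {A : Eucl d →L[ℝ] F} (hA : ¬ Function.Injective A)
    {η : ℝ≥0} (hη : 0 < η) :
    ∃ δ : ℝ≥0, δ ≠ 0 ∧ ∀ (s : Set (Eucl d)) (f : Eucl d → F), ApproximatesLinearOn f A s δ →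
      μHE[d] (f '' s) ≤ η * volume s := by
  let J : F × Eucl d →L[ℝ] WithLp 2 (F × Eucl d) :=
    (WithLp.prodContinuousLinearEquiv 2 ℝ F (Eucl d)).symm.toContinuousLinearMap
  let B : ℝ≥0 → Eucl d →L[ℝ] WithLp 2 (F × Eucl d) := fun ε =>
    J ∘L (A.prod 0) + (ε : ℝ) • J ∘L ((0 : Eucl d →L[ℝ] F).prod (.id ℝ (Eucl d)))
  have hfst : ∀ ε v, (B ε v).fst = A v := fun ε v => by simp [B, J]
  have hsnd : ∀ ε v, (B ε v).snd = (ε : ℝ) • v := fun ε v => by simp [B, J]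
  have hB0 : (B 0).toLinearMap.normDet = 0 := by
    refine ((B 0).toLinearMap.normDet_eq_zero_tfae.out 0 5).2
      fun (h : Function.Injective (B 0)) => hA fun x y hxy => h ?_
    simp [B, hxy]
  have hBc : Continuous B := by
    exact continuous_const.add (NNReal.continuous_coe.smul continuous_const)
  have hlim : Tendsto (fun ε => (2 : ℝ≥0∞) ^ d * ENNReal.ofReal (B ε).toLinearMap.normDet)
      (𝓝 0) (𝓝 0) := by
    have h1 := (ENNReal.continuous_ofReal.comp (continuous_normDet.comp hBc)).tendsto 0
    have h2 := ENNReal.Tendsto.const_mul (a := (2 : ℝ≥0∞) ^ d) h1 (Or.inr (by simp))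
    simpa [hB0] using h2
  obtain ⟨ε, hε, hε0⟩ := ((hlim.mono_left nhdsWithin_le_nhds).eventually_lt_const
    (show (0 : ℝ≥0∞) < η by exact_mod_cast hη) |>.and
      (self_mem_nhdsWithin (s := Ioi (0 : ℝ≥0)))).exists
  refine ⟨ε, (ne_of_gt hε0), fun s f hf => ?_⟩
  calc μHE[d] (f '' s) ≤ ((2 : ℝ≥0) : ℝ≥0∞) ^ d * μHE[d] (B ε '' s) := by
        refine euclideanHausdorffMeasure_image_le_of_edist_le fun x hx y hy => ?_
        simp only [edist_eq_enorm_sub, ← map_sub, enorm_eq_nnnorm]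
        have h1 : ‖f x - f y‖ ≤ 2 * ‖B ε (x - y)‖ := by
          have h2 := hf x hx y hy
          have h3 : ‖A (x - y)‖ ≤ ‖B ε (x - y)‖ := by
            rw [← hfst ε]
            exact WithLp.norm_fst_le _ _
          have h4 : ‖(ε : ℝ) • (x - y)‖ ≤ ‖B ε (x - y)‖ := by
            rw [← hsnd ε]
            exact WithLp.norm_snd_le _ _
          rw [norm_smul, Real.norm_of_nonneg ε.coe_nonneg] at h4
          have h5 : ‖f x - f y‖ ≤ ‖f x - f y - A (x - y)‖ + ‖A (x - y)‖ := by
            simpa using norm_add_le (f x - f y - A (x - y)) (A (x - y))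
          linarith
        exact_mod_cast h1
    _ = (2 : ℝ≥0∞) ^ d * ENNReal.ofReal (B ε).toLinearMap.normDet * volume s := by
        rw [euclideanHausdorffMeasure_linear_image, mul_assoc]
        rfl
    _ ≤ η * volume s := by gcongr

/-- The image of the set of critical points is a null set. -/
theorem euclideanHausdorffMeasure_image_eq_zero_of_not_injective [FiniteDimensional ℝ F]
    {f : Eucl d → F} {f' : Eucl d → Eucl d →L[ℝ] F} {s : Set (Eucl d)} (hs : MeasurableSet s)
    (hf' : ∀ x ∈ s, HasFDerivWithinAt f (f' x) s x)
    (hinj' : ∀ x ∈ s, ¬ Function.Injective (f' x)) : μHE[d] (f '' s) = 0 := by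
  -- Finite volume is needed for the bound `η * volume s'` to tend to `0` with `η`.
  suffices H : ∀ s' ⊆ s, MeasurableSet s' → volume s' ≠ ∞ → μHE[d] (f '' s') = 0 by
    have h1 : s = ⋃ k, s ∩ spanningSets (volume : Measure (Eucl d)) k := by
      rw [← inter_iUnion, iUnion_spanningSets, inter_univ]
    rw [h1, image_iUnion, measure_iUnion_null_iff]
    intro k
    refine H _ inter_subset_left (hs.inter (measurableSet_spanningSets _ k)) ?_
    exact ((measure_mono inter_subset_right).trans_lt (measure_spanningSets_lt_top _ k)).ne
  clear hs
  intro s' hs's hs' hfin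
  rcases s'.eq_empty_or_nonempty with rfl | hne
  · simp
  have key : ∀ η : ℝ≥0, 0 < η → μHE[d] (f '' s') ≤ η * volume s' := by
    intro η hη
    have hr : ∀ A : Eucl d →L[ℝ] F, ∃ δ : ℝ≥0, δ ≠ 0 ∧ (¬ Function.Injective A →
        ∀ (s : Set (Eucl d)) (f : Eucl d → F), ApproximatesLinearOn f A s δ →
          μHE[d] (f '' s) ≤ η * volume s) := by
      intro A
      by_cases hA : Function.Injective A
      · exact ⟨1, one_ne_zero, fun h => absurd hA h⟩
      · obtain ⟨δ, h1, h2⟩ := exists_approximatesLinearOn_image_le hA hη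
        exact ⟨δ, h1, fun _ => h2⟩
    choose r hr0 hr using hr
    obtain ⟨t, A, hdisj, hmeas, hcov, happ, hA⟩ :=
      exists_partition_approximatesLinearOn_of_hasFDerivWithinAt f s' f'
        (fun x hx => (hf' x (hs's hx)).mono hs's) r hr0
    have hst : s' = ⋃ k, s' ∩ t k := by
      rw [← inter_iUnion, inter_eq_left.2 hcov]
    have hAinj : ∀ k, ¬ Function.Injective (A k) := by
      intro k
      obtain ⟨y, hy, h⟩ := hA hne k
      rw [h]
      exact hinj' y (hs's hy)
    calc μHE[d] (f '' s') ≤ ∑' k, μHE[d] (f '' (s' ∩ t k)) := by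
          conv_lhs => rw [hst, image_iUnion]
          exact measure_iUnion_le _
      _ ≤ ∑' k, η * volume (s' ∩ t k) :=
          ENNReal.tsum_le_tsum fun k => hr _ (hAinj k) _ _ (happ k)
      _ = η * volume s' := by
          rw [ENNReal.tsum_mul_left, ← measure_iUnion _ fun k => hs'.inter (hmeas k), ← hst]
          exact fun i j hij => (hdisj hij).mono inter_subset_right inter_subset_right
  have hlim : Tendsto (fun η : ℝ≥0 => (η : ℝ≥0∞) * volume s') (𝓝[>] 0) (𝓝 0) := by
    have h1 : Tendsto (fun η : ℝ≥0 => (η : ℝ≥0∞)) (𝓝[>] 0) (𝓝 ((0 : ℝ≥0) : ℝ≥0∞)) :=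
      (ENNReal.continuous_coe.tendsto 0).mono_left nhdsWithin_le_nhds
    simpa using ENNReal.Tendsto.mul_const h1 (Or.inr hfin)
  exact le_antisymm
    (ge_of_tendsto hlim (eventually_nhdsWithin_of_forall fun η hη => key η hη)) bot_le

end Area

/-! ### The Grassmannian as a compact space -/

section Grassmannian

variable {d n : ℕ}

lemma Gr.isInducing_starProjection :
    IsInducing (fun T : Gr d n => T.1.starProjection) := ⟨rfl⟩

lemma Gr.continuous_starProjection :
    Continuous (fun T : Gr d n => T.1.starProjection) := Gr.isInducing_starProjection.continuous

lemma Gr.injective_starProjection :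
    Function.Injective (fun T : Gr d n => T.1.starProjection) := by
  intro T T' h
  exact Subtype.ext (Submodule.starProjection_inj.1 h)

instance : T2Space (Gr d n) :=
  T2Space.of_injective_continuous Gr.injective_starProjection Gr.continuous_starProjection

instance : SecondCountableTopology (Gr d n) :=
  have : ProperSpace (Eucl n →L[ℝ] Eucl n) := FiniteDimensional.proper_real _
  Gr.isInducing_starProjection.secondCountableTopology

/-- Orthonormal `d`-frames in `ℝⁿ`. -/
abbrev OrthoFrame (d n : ℕ) : Type := {v : Fin d → Eucl n // Orthonormal ℝ v}

lemma isClosed_setOf_orthonormal : IsClosed {v : Fin d → Eucl n | Orthonormal ℝ v} := by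
  simp only [orthonormal_iff_ite, ofPred_forall]
  refine isClosed_iInter fun i => isClosed_iInter fun j => isClosed_eq ?_ continuous_const
  fun_prop

lemma isCompact_setOf_orthonormal : IsCompact {v : Fin d → Eucl n | Orthonormal ℝ v} := by
  refine (isCompact_closedBall (0 : Fin d → Eucl n) 1).of_isClosed_subset
    isClosed_setOf_orthonormal fun v hv => ?_
  rw [mem_closedBall_zero_iff, pi_norm_le_iff_of_nonneg zero_le_one]
  exact fun i => (hv.1 i).le

instance : CompactSpace (OrthoFrame d n) :=
  isCompact_iff_compactSpace.1 isCompact_setOf_orthonormal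

/-- The plane spanned by a frame. -/
def Gr.ofFrame (v : Fin d → Eucl n) (h : LinearIndependent ℝ v) : Gr d n :=
  ⟨Submodule.span ℝ (range v), by rw [finrank_span_eq_card h, Fintype.card_fin]⟩

lemma onFrames_of_linearIndependent (Ψ : Gr d n → ℝ) {v : Fin d → Eucl n}
    (h : LinearIndependent ℝ v) : onFrames Ψ v = Ψ (Gr.ofFrame v h) := dif_pos h

/-- The plane spanned by an orthonormal frame. -/
def OrthoFrame.plane (v : OrthoFrame d n) : Gr d n := Gr.ofFrame v.1 v.2.linearIndependent

lemma OrthoFrame.starProjection_plane_apply (v : OrthoFrame d n) (x : Eucl n) :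
    v.plane.1.starProjection x = ∑ i, inner ℝ (v.1 i) x • v.1 i := by
  refine Submodule.eq_starProjection_of_mem_of_inner_eq_zero ?_ ?_
  · exact Submodule.sum_mem _ fun i _ =>
      Submodule.smul_mem _ _ (Submodule.subset_span (mem_range_self i))
  · intro w hw
    induction hw using Submodule.span_induction with
    | mem w hw =>
      obtain ⟨j, rfl⟩ := hw
      simp [inner_sub_left, sum_inner, inner_smul_left, orthonormal_iff_ite.1 v.2,
        real_inner_comm]
    | zero => simp
    | add a b _ _ ha hb => rw [inner_add_right, ha, hb, add_zero]
    | smul c a _ ha => rw [inner_smul_right, ha, mul_zero]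

lemma OrthoFrame.continuous_plane :
    Continuous (OrthoFrame.plane : OrthoFrame d n → Gr d n) := by
  rw [Gr.isInducing_starProjection.continuous_iff, continuous_clm_apply]
  intro x
  simp only [Function.comp_def, OrthoFrame.starProjection_plane_apply]
  refine continuous_finsetSum _ fun i _ => ?_
  have h : Continuous fun v : OrthoFrame d n => v.1 i :=
    (continuous_apply i).comp continuous_subtype_val
  exact (h.inner (𝕜 := ℝ) continuous_const).smul h

lemma OrthoFrame.surjective_plane :
    Function.Surjective (OrthoFrame.plane : OrthoFrame d n → Gr d n) := by
  intro T
  let b := (stdOrthonormalBasis ℝ T.1).reindex (finCongr T.2)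
  refine ⟨⟨fun i => (b i : Eucl n), b.orthonormal.comp_linearIsometry T.1.subtypeₗᵢ⟩, ?_⟩
  apply Subtype.ext
  change Submodule.span ℝ (range fun i => (b i : Eucl n)) = T.1
  have h1 : (range fun i => (b i : Eucl n)) = T.1.subtype '' range b := by
    rw [← range_comp]; rfl
  rw [h1, Submodule.span_image, ← b.coe_toBasis, b.toBasis.span_eq, Submodule.map_top,
    Submodule.range_subtype]

instance : CompactSpace (Gr d n) :=
  OrthoFrame.surjective_plane.compactSpace OrthoFrame.continuous_plane

/-- A product of a quotient map with the identity need not be a quotient map. Here `plane` is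
proper, so the product is closed. Continuity on `X × Gr d n` can then be tested on orthonormal
frames. -/
lemma isQuotientMap_prodMap_plane (X : Type*) [TopologicalSpace X] :
    IsQuotientMap (Prod.map id OrthoFrame.plane : X × OrthoFrame d n → X × Gr d n) :=
  (isProperMap_id.prodMap OrthoFrame.continuous_plane.isProperMap).isClosedMap.isQuotientMap
    (continuous_id.prodMap OrthoFrame.continuous_plane)
    (Function.surjective_id.prodMap OrthoFrame.surjective_plane)

lemma isQuotientMap_plane : IsQuotientMap (OrthoFrame.plane : OrthoFrame d n → Gr d n) :=
  OrthoFrame.continuous_plane.isClosedMap.isQuotientMap OrthoFrame.continuous_plane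
    OrthoFrame.surjective_plane

/-- The preimage of a closed set is the projection of a closed set along a compact factor. For maps
into the compact Grassmannian, continuity thus reduces to writing the graph by closed conditions. -/
lemma continuous_of_isClosed_graph {X Y : Type*} [TopologicalSpace X] [TopologicalSpace Y]
    [CompactSpace Y] {f : X → Y} (hf : IsClosed {p : X × Y | p.2 = f p.1}) : Continuous f := by
  refine continuous_iff_isClosed.2 fun C hC => ?_
  have h : f ⁻¹' C = Prod.fst '' ({p : X × Y | p.2 = f p.1} ∩ Prod.snd ⁻¹' C) := by
    ext x
    constructor
    · exact fun hx => ⟨(x, f x), ⟨rfl, hx⟩, rfl⟩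
    · rintro ⟨⟨a, b⟩, ⟨h1, h2⟩, rfl⟩
      have h1 : b = f a := h1
      exact h1 ▸ h2
  rw [h]
  exact isClosedMap_fst_of_compactSpace _ (hf.inter (hC.preimage continuous_snd))

lemma Gr.eq_of_le {T T' : Gr d n} (h : T.1 ≤ T'.1) : T = T' :=
  Subtype.ext (Submodule.eq_of_le_of_finrank_eq h (T.2.trans T'.2.symm))

lemma Gr.map_coe {L : Eucl n →L[ℝ] Eucl n} (hL : Function.Injective L) (T : Gr d n) :
    (Gr.map L T).1 = T.1.map L.toLinearMap := by
  have h : Module.finrank ℝ (T.1.map L.toLinearMap) = d := by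
    rw [← (Submodule.equivMapOfInjective L.toLinearMap hL T.1).finrank_eq, T.2]
  simp [Gr.map, h]

/-- The graph is closed: `T' = L T` holds iff the projection onto `T'` fixes `L (π_T y)` for all
`y`. This says only `L T ≤ T'`, which suffices because the dimensions agree. -/
lemma continuous_Gr_map {X : Type*} [TopologicalSpace X] {L : X → Eucl n →L[ℝ] Eucl n}
    (hL : Continuous L) (hinj : ∀ x, Function.Injective (L x)) :
    Continuous fun p : X × Gr d n => Gr.map (L p.1) p.2 := by
  apply continuous_of_isClosed_graph
  have h : {p : (X × Gr d n) × Gr d n | p.2 = Gr.map (L p.1.1) p.1.2} =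
      ⋂ y, {p | p.2.1.starProjection (L p.1.1 (p.1.2.1.starProjection y)) =
        L p.1.1 (p.1.2.1.starProjection y)} := by
    ext ⟨⟨x, T⟩, T'⟩
    simp only [mem_ofPred_eq, mem_iInter, Submodule.starProjection_eq_self_iff]
    constructor
    · rintro rfl y
      rw [Gr.map_coe (hinj x)]
      exact Submodule.mem_map_of_mem (Submodule.starProjection_apply_mem _ _)
    · intro h
      refine (Gr.eq_of_le ?_).symm
      rw [Gr.map_coe (hinj x)]
      rintro _ ⟨y, hy, rfl⟩
      have := h y
      rwa [Submodule.starProjection_eq_self_iff.2 hy] at this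
  rw [h]
  have h1 : Continuous fun p : (X × Gr d n) × Gr d n => p.1.2.1.starProjection :=
    Gr.continuous_starProjection.comp (continuous_snd.comp continuous_fst)
  have h2 : Continuous fun p : (X × Gr d n) × Gr d n => p.2.1.starProjection :=
    Gr.continuous_starProjection.comp continuous_snd
  have h3 : Continuous fun p : (X × Gr d n) × Gr d n => L p.1.1 :=
    hL.comp (continuous_fst.comp continuous_fst)
  refine isClosed_iInter fun y => isClosed_eq ?_ ?_
  · exact h2.clm_apply (h3.clm_apply (h1.clm_apply continuous_const))
  · exact h3.clm_apply (h1.clm_apply continuous_const)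

/-- The Jacobian of `L` on a plane is computed by any orthonormal frame of the plane. -/
lemma planeJacobian_plane (L : Eucl n →L[ℝ] Eucl n) (v : OrthoFrame d n) :
    planeJacobian L v.plane = √(Matrix.gram ℝ fun i => L (v.1 i)).det := by
  let b : OrthonormalBasis (Fin d) ℝ v.plane.1 := OrthonormalBasis.mk
    (v := fun i => ⟨v.1 i, Submodule.subset_span (mem_range_self i)⟩)
    (by
      rw [orthonormal_iff_ite]
      intro i j
      exact orthonormal_iff_ite.1 v.2 i j)
    (by
      rintro ⟨x, hx⟩ -
      have h1 : v.plane.1 = Submodule.map v.plane.1.subtype (Submodule.span ℝ (range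
          fun i => (⟨v.1 i, Submodule.subset_span (mem_range_self i)⟩ : v.plane.1))) := by
        rw [← Submodule.span_image, ← range_comp]
        rfl
      have h2 := hx
      rw [h1] at h2
      obtain ⟨y, hy, hyx⟩ := h2
      have : y = ⟨x, hx⟩ := Subtype.ext hyx
      exact this ▸ hy)
  have h := (L.toLinearMap.comp v.plane.1.subtype).normDet_sq_eq_det_gram b
  have h' : (planeJacobian L v.plane) ^ 2 = (Matrix.gram ℝ fun i => L (v.1 i)).det := by
    rw [planeJacobian]
    refine h.trans ?_
    simp [b]
  rw [← h', Real.sqrt_sq]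
  exact LinearMap.normDet_nonneg _

lemma continuous_gram_det : Continuous fun v : Fin d → Eucl n => (Matrix.gram ℝ v).det := by
  refine Continuous.matrix_det (continuous_matrix fun i j => ?_)
  simp only [Matrix.gram_apply]
  fun_prop

lemma planeJacobian_nonneg (L : Eucl n →L[ℝ] Eucl n) (T : Gr d n) : 0 ≤ planeJacobian L T :=
  LinearMap.normDet_nonneg _

/-- The domain of the restricted map varies with `T`. Passing to orthonormal frames replaces it by a
Gram determinant of fixed size. -/
lemma continuous_planeJacobian :
    Continuous fun p : (Eucl n →L[ℝ] Eucl n) × Gr d n => planeJacobian p.1 p.2 := by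
  rw [(isQuotientMap_prodMap_plane _).continuous_iff]
  simp only [Function.comp_def, Prod.map_fst, Prod.map_snd, id, planeJacobian_plane]
  refine Real.continuous_sqrt.comp (continuous_gram_det.comp (continuous_pi fun i => ?_))
  exact continuous_fst.clm_apply ((continuous_apply i).comp (continuous_subtype_val.comp
    continuous_snd))

lemma IsC1Integrand.continuous {Ψ : Gr d n → ℝ} (hΨ : IsC1Integrand Ψ) : Continuous Ψ := by
  rw [isQuotientMap_plane.continuous_iff]
  have h : Ψ ∘ OrthoFrame.plane = fun v : OrthoFrame d n => onFrames Ψ v.1 := by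
    ext v
    rw [onFrames_of_linearIndependent Ψ v.2.linearIndependent]
    rfl
  rw [h]
  exact hΨ.contDiffOn.continuousOn.comp_continuous continuous_subtype_val
    fun v => v.2.linearIndependent

end Grassmannian

/-! ### Linear images of oriented planes -/

section Oriented

variable {d n : ℕ}

/-- In the orthonormal basis of the exterior power, the coordinates are determinants of inner
products with basis vectors. -/
lemma continuous_ιMulti : Continuous fun v : Fin d → Eucl n => exteriorPower.ιMulti ℝ d v := by
  let b := (EuclideanSpace.basisFun (Fin n) ℝ).exteriorPower d
  have h : ∀ v : Fin d → Eucl n, exteriorPower.ιMulti ℝ d v =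
      ∑ s, inner ℝ (b s) (exteriorPower.ιMulti ℝ d v) • b s := fun v => (b.sum_repr' _).symm
  rw [funext h]
  refine continuous_finsetSum _ fun s _ => Continuous.fun_smul ?_ continuous_const
  have hb : b s = exteriorPower.ιMulti_family ℝ d (EuclideanSpace.basisFun (Fin n) ℝ) s := by
    have h1 := congrFun ((EuclideanSpace.basisFun (Fin n) ℝ).exteriorPower d).coe_toBasis s
    rw [OrthonormalBasis.toBasis_exteriorPower, exteriorPower.coe_basis] at h1
    rw [← OrthonormalBasis.coe_toBasis]
    exact h1.symm
  simp only [hb, exteriorPower.ιMulti_family, exteriorPower.inner_ιMulti_ιMulti]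
  refine Continuous.matrix_det (continuous_matrix fun i j => ?_)
  simp only [Matrix.of_apply]
  fun_prop

lemma continuous_exteriorPower_map :
    Continuous fun p : (Eucl n →L[ℝ] Eucl n) × ⋀[ℝ]^d (Eucl n) =>
      exteriorPower.map d p.1.toLinearMap p.2 := by
  let b := (EuclideanSpace.basisFun (Fin n) ℝ).toBasis.exteriorPower d
  have h : ∀ p : (Eucl n →L[ℝ] Eucl n) × ⋀[ℝ]^d (Eucl n),
      exteriorPower.map d p.1.toLinearMap p.2 =
        ∑ s, b.repr p.2 s • exteriorPower.map d p.1.toLinearMap (b s) := by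
    intro p
    conv_lhs => rw [← b.sum_repr p.2]
    simp only [map_sum, map_smul]
  rw [funext h]
  refine continuous_finsetSum _ fun s _ => Continuous.fun_smul ?_ ?_
  · exact ((b.coord s).continuous_of_finiteDimensional).comp continuous_snd
  · simp only [b, exteriorPower.coe_basis, exteriorPower.ιMulti_family,
      exteriorPower.map_apply_ιMulti]
    refine continuous_ιMulti.comp (continuous_pi fun i => ?_)
    exact continuous_fst.clm_apply continuous_const

lemma norm_ιMulti (v : Fin d → Eucl n) :
    ‖exteriorPower.ιMulti ℝ d v‖ = √(Matrix.gram ℝ v).det := by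
  rw [← exteriorPower.inner_ιMulti_self, real_inner_self_eq_norm_sq, Real.sqrt_sq (norm_nonneg _)]

lemma norm_ιMulti_of_orthonormal {v : Fin d → Eucl n} (hv : Orthonormal ℝ v) :
    ‖exteriorPower.ιMulti ℝ d v‖ = 1 := by
  have h : Matrix.gram ℝ v = 1 := by
    ext i j
    rw [Matrix.gram_apply, orthonormal_iff_ite.1 hv, Matrix.one_apply]
  rw [norm_ιMulti, h, Matrix.det_one, Real.sqrt_one]

lemma norm_ιMulti_ne_zero {v : Fin d → Eucl n} (hv : LinearIndependent ℝ v) :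
    ‖exteriorPower.ιMulti ℝ d v‖ ≠ 0 := by
  intro h
  have h1 := exteriorPower.inner_ιMulti_self v
  rw [norm_eq_zero.1 h, inner_zero_left] at h1
  exact (Matrix.det_gram_ne_zero_iff_linearIndependent (𝕜 := ℝ)).2 hv h1.symm

/-- Alternating `d`-forms on a `d`-dimensional space are multiples of the determinant. With `u` an
orthonormal frame of the span of `v`, the scalar is the determinant of `v` in the basis `u`, as
every dual functional confirms. -/
lemma exists_ιMulti_eq_smul {v : Fin d → Eucl n} (hv : LinearIndependent ℝ v) :
    ∃ u : Fin d → Eucl n, Orthonormal ℝ u ∧ ∃ c : ℝ,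
      exteriorPower.ιMulti ℝ d v = c • exteriorPower.ιMulti ℝ d u := by
  obtain ⟨u, hu⟩ := OrthoFrame.surjective_plane (Gr.ofFrame v hv)
  have hspan : Submodule.span ℝ (range u.1) = Submodule.span ℝ (range v) :=
    congrArg Subtype.val hu
  have hvu : ∀ i, v i ∈ Submodule.span ℝ (range u.1) := fun i => by
    rw [hspan]
    exact Submodule.subset_span (mem_range_self i)
  let b := Module.Basis.span u.2.linearIndependent
  let v' : Fin d → Submodule.span ℝ (range u.1) := fun i => ⟨v i, hvu i⟩
  refine ⟨u.1, u.2, b.det v', ?_⟩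
  rw [← sub_eq_zero, ← Module.forall_dual_apply_eq_zero_iff ℝ]
  intro ℓ
  let f : (Submodule.span ℝ (range u.1)) [⋀^Fin d]→ₗ[ℝ] ℝ :=
    (ℓ.compAlternatingMap (exteriorPower.ιMulti ℝ d)).compLinearMap (Submodule.subtype _)
  have h1 := congrArg (fun g => g v') (AlternatingMap.eq_smul_basis_det b f)
  have h2 : f v' = ℓ (exteriorPower.ιMulti ℝ d v) := rfl
  have h3 : f b = ℓ (exteriorPower.ιMulti ℝ d u.1) := by
    have : (fun i => ((b i : Submodule.span ℝ (range u.1)) : Eucl n)) = u.1 := by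
      ext1 i
      simp [b, Module.Basis.span_apply]
    change ℓ (exteriorPower.ιMulti ℝ d (fun i => ((b i : Submodule.span ℝ (range u.1)) : Eucl n)))
      = _
    rw [this]
  simp only [AlternatingMap.smul_apply, h2, h3, smul_eq_mul] at h1
  rw [map_sub, map_smul, h1, smul_eq_mul, mul_comm, sub_self]

lemma exists_normalize_ιMulti {v : Fin d → Eucl n} (hv : LinearIndependent ℝ v) :
    ∃ u : Fin d → Eucl n, Orthonormal ℝ u ∧
      (‖exteriorPower.ιMulti ℝ d v‖⁻¹ • exteriorPower.ιMulti ℝ d v = exteriorPower.ιMulti ℝ d u ∨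
        ‖exteriorPower.ιMulti ℝ d v‖⁻¹ • exteriorPower.ιMulti ℝ d v =
          -exteriorPower.ιMulti ℝ d u) := by
  obtain ⟨u, hu, c, hc⟩ := exists_ιMulti_eq_smul hv
  have hn : ‖exteriorPower.ιMulti ℝ d v‖ = |c| := by
    rw [hc, norm_smul, norm_ιMulti_of_orthonormal hu, mul_one, Real.norm_eq_abs]
  have hc0 : c ≠ 0 := by
    intro h
    apply norm_ιMulti_ne_zero hv
    rw [hn, h, abs_zero]
  refine ⟨u, hu, ?_⟩
  rw [hn, hc, smul_smul]
  rcases lt_or_gt_of_ne hc0 with h | h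
  · right
    rw [abs_of_neg h, inv_neg, neg_mul, inv_mul_cancel₀ hc0, neg_smul, one_smul]
  · left
    rw [abs_of_pos h, inv_mul_cancel₀ hc0, one_smul]

lemma spaceOf_smul {c : ℝ} (hc : c ≠ 0) (w : ⋀[ℝ]^d (Eucl n)) : spaceOf (c • w) = spaceOf w := by
  ext x
  simp [spaceOf, hc]

/-- The multivector of an oriented plane is, up to sign, that of an orthonormal frame. -/
lemma OrientedGr.exists_frame (P : OrientedGr d n) : ∃ v : OrthoFrame d n, P.forget = v.plane ∧
    (P.1 = exteriorPower.ιMulti ℝ d v.1 ∨ P.1 = -exteriorPower.ιMulti ℝ d v.1) := by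
  obtain ⟨v, hv, h⟩ := P.2
  refine ⟨⟨v, hv⟩, Subtype.ext ?_, h⟩
  rcases h with h | h
  · change spaceOf P.1 = Submodule.span ℝ (range v)
    rw [h, spaceOf_ιMulti hv.linearIndependent]
  · change spaceOf P.1 = Submodule.span ℝ (range v)
    rw [h, spaceOf_neg, spaceOf_ιMulti hv.linearIndependent]

/-- The Jacobian is the factor by which `L` stretches the unit `d`-vector, hence the right
normalization in `OrientedGr.map`. -/
lemma norm_exteriorPower_map (L : Eucl n →L[ℝ] Eucl n) (P : OrientedGr d n) :
    ‖exteriorPower.map d L.toLinearMap P.1‖ = planeJacobian L P.forget := by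
  obtain ⟨v, hv, h⟩ := P.exists_frame
  rw [hv, planeJacobian_plane]
  rcases h with h | h
  · rw [h, exteriorPower.map_apply_ιMulti, norm_ιMulti]
    rfl
  · rw [h, map_neg, norm_neg, exteriorPower.map_apply_ιMulti, norm_ιMulti]
    rfl

lemma planeJacobian_pos {L : Eucl n →L[ℝ] Eucl n} (hL : Function.Injective L) (T : Gr d n) :
    0 < planeJacobian L T := by
  refine lt_of_le_of_ne (planeJacobian_nonneg L T) (Ne.symm ?_)
  exact ((L.toLinearMap.comp T.1.subtype).normDet_ne_zero_tfae.out 0 4).2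
    (hL.comp Subtype.val_injective)

/-- The normalized image of an oriented plane under an injective linear map. -/
def OrientedGr.map (L : Eucl n →L[ℝ] Eucl n) (hL : Function.Injective L) (P : OrientedGr d n) :
    OrientedGr d n :=
  ⟨(planeJacobian L P.forget)⁻¹ • exteriorPower.map d L.toLinearMap P.1, by
    obtain ⟨v, hv, h⟩ := P.exists_frame
    have hli : LinearIndependent ℝ (L.toLinearMap ∘ v.1) :=
      v.2.linearIndependent.map' _ (LinearMap.ker_eq_bot.2 hL)
    obtain ⟨u, hu, hor⟩ := exists_normalize_ιMulti hli
    refine ⟨u, hu, ?_⟩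
    rw [← norm_exteriorPower_map]
    rcases h with h | h
    · rw [h, exteriorPower.map_apply_ιMulti]
      exact hor
    · rw [h, map_neg, norm_neg, exteriorPower.map_apply_ιMulti, smul_neg, neg_inj,
        neg_eq_iff_eq_neg]
      exact hor.symm⟩

lemma OrientedGr.forget_map (L : Eucl n →L[ℝ] Eucl n) (hL : Function.Injective L)
    (P : OrientedGr d n) : (P.map L hL).forget = Gr.map L P.forget := by
  apply Subtype.ext
  rw [Gr.map_coe hL]
  obtain ⟨v, hv, h⟩ := P.exists_frame
  have hli : LinearIndependent ℝ (L.toLinearMap ∘ v.1) :=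
    v.2.linearIndependent.map' _ (LinearMap.ker_eq_bot.2 hL)
  have h1 : spaceOf (exteriorPower.ιMulti ℝ d (L.toLinearMap ∘ v.1)) =
      P.forget.1.map L.toLinearMap := by
    rw [hv, spaceOf_ιMulti hli, range_comp, Submodule.span_image]
    rfl
  change spaceOf ((planeJacobian L P.forget)⁻¹ • exteriorPower.map d L.toLinearMap P.1) = _
  rw [spaceOf_smul (inv_ne_zero (planeJacobian_pos hL _).ne'), ← h1]
  rcases h with h | h
  · rw [h, exteriorPower.map_apply_ιMulti]
  · rw [h, map_neg, spaceOf_neg, exteriorPower.map_apply_ιMulti]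

/-- The graph is closed: `T` is the plane of `w` iff `π_T y ∧ w = 0` for all `y`, by equality of
dimensions. Tested against functionals `ℓ`, these are bilinear equations on finite-dimensional
spaces. -/
lemma OrientedGr.continuous_forget :
    Continuous (OrientedGr.forget : OrientedGr d n → Gr d n) := by
  apply continuous_of_isClosed_graph
  let B : Module.Dual ℝ (ExteriorAlgebra ℝ (Eucl n)) → Eucl n →ₗ[ℝ] ⋀[ℝ]^d (Eucl n) →ₗ[ℝ] ℝ :=
    fun ℓ => LinearMap.mk₂ ℝ
      (fun y w => ℓ (ExteriorAlgebra.ι ℝ y * (w : ExteriorAlgebra ℝ (Eucl n))))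
      (fun y y' w => by simp [add_mul]) (fun c y w => by simp)
      (fun y w w' => by simp [mul_add]) (fun c y w => by simp)
  have hB : ∀ ℓ, Continuous fun p : Eucl n × ⋀[ℝ]^d (Eucl n) => B ℓ p.1 p.2 := fun ℓ =>
    (LinearMap.toContinuousBilinearMap (𝕜 := ℝ) (E := Eucl n) (F := ⋀[ℝ]^d (Eucl n))
      (G := ℝ) (B ℓ)).continuous₂
  have h : {p : OrientedGr d n × Gr d n | p.2 = p.1.forget} =
      ⋂ (y) (ℓ), {p | B ℓ (p.2.1.starProjection y) p.1.1 = 0} := by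
    ext ⟨P, T⟩
    simp only [mem_ofPred_eq, mem_iInter, B, LinearMap.mk₂_apply]
    simp only [Module.forall_dual_apply_eq_zero_iff ℝ]
    constructor
    · rintro rfl y
      have h1 : P.forget.1.starProjection y ∈ spaceOf P.1 :=
        Submodule.starProjection_apply_mem _ _
      simpa [spaceOf] using h1
    · intro h
      refine Gr.eq_of_le fun x hx => ?_
      have h1 := h x
      rw [Submodule.starProjection_eq_self_iff.2 hx] at h1
      change x ∈ spaceOf P.1
      simpa [spaceOf] using h1
  rw [h]
  refine isClosed_iInter fun y => isClosed_iInter fun ℓ => isClosed_eq ?_ continuous_const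
  refine (hB ℓ).comp (Continuous.prodMk ?_ (continuous_subtype_val.comp continuous_fst))
  exact (Gr.continuous_starProjection.comp continuous_snd).clm_apply continuous_const

lemma OrientedGr.continuous_map {X : Type*} [TopologicalSpace X] {L : X → Eucl n →L[ℝ] Eucl n}
    (hL : Continuous L) (hinj : ∀ x, Function.Injective (L x)) :
    Continuous fun p : X × OrientedGr d n => p.2.map (L p.1) (hinj p.1) := by
  have hL' : Continuous fun p : X × OrientedGr d n => L p.1 := hL.comp continuous_fst
  have hf : Continuous fun p : X × OrientedGr d n => p.2.forget :=
    OrientedGr.continuous_forget.comp continuous_snd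
  have hw : Continuous fun p : X × OrientedGr d n => p.2.1 :=
    continuous_subtype_val.comp continuous_snd
  have h1 : Continuous fun p : X × OrientedGr d n => planeJacobian (L p.1) p.2.forget :=
    Continuous.comp (f := fun p : X × OrientedGr d n => (L p.1, p.2.forget))
      continuous_planeJacobian (hL'.prodMk hf)
  have h2 : Continuous fun p : X × OrientedGr d n =>
      exteriorPower.map d (L p.1).toLinearMap p.2.1 :=
    Continuous.comp (f := fun p : X × OrientedGr d n => (L p.1, p.2.1))
      continuous_exteriorPower_map (hL'.prodMk hw)
  have h3 : Continuous fun p : X × OrientedGr d n => (planeJacobian (L p.1) p.2.forget)⁻¹ :=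
    h1.inv₀ fun p => (planeJacobian_pos (hinj p.1) _).ne'
  exact Continuous.subtype_mk (h3.fun_smul h2) _

lemma pairing_smul {m : ℕ} (τ : Eucl n [⋀^Fin m]→L[ℝ] ℝ) (c : ℝ) (w : ⋀[ℝ]^m (Eucl n)) :
    pairing τ (c • w) = c * pairing τ w := by
  simp [pairing]

lemma pairing_exteriorPower_map {m : ℕ} (τ : Eucl n [⋀^Fin m]→L[ℝ] ℝ)
    (L : Eucl n →L[ℝ] Eucl n) (w : ⋀[ℝ]^m (Eucl n)) :
    pairing τ (exteriorPower.map m L.toLinearMap w) =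
      pairing (τ.compContinuousLinearMap L) w := by
  have h : (exteriorPower.alternatingMapLinearEquiv τ.toAlternatingMap).comp
      (exteriorPower.map m L.toLinearMap) =
      exteriorPower.alternatingMapLinearEquiv (τ.compContinuousLinearMap L).toAlternatingMap := by
    apply exteriorPower.linearMap_ext
    ext v
    simp [Function.comp_def]
  exact congrArg (fun f => f w) h

/-- The Jacobian from the change of variables cancels the normalization of the image plane. This is
the pointwise form of `(f_♯ A)(τ) = A(f^* τ)`. -/
lemma planeJacobian_mul_pairing_map {m : ℕ} (τ : Eucl n [⋀^Fin m]→L[ℝ] ℝ)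
    (L : Eucl n →L[ℝ] Eucl n) (hL : Function.Injective L) (P : OrientedGr m n) :
    planeJacobian L P.forget * pairing τ (P.map L hL).1 =
      pairing (τ.compContinuousLinearMap L) P.1 := by
  rw [OrientedGr.map, pairing_smul, ← mul_assoc, mul_inv_cancel₀ (planeJacobian_pos hL _).ne',
    one_mul, pairing_exteriorPower_map]

end Oriented

/-! ### Change of variables on rectifiable sets -/

section Rectifiable

variable {d n : ℕ}

lemma measurableSet_injective_fderiv (φ : Eucl d → Eucl n) :
    MeasurableSet {y | DifferentiableAt ℝ φ y ∧ Function.Injective (fderiv ℝ φ y)} := by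
  have h : {y | Function.Injective (fderiv ℝ φ y)} =
      {y | (fderiv ℝ φ y).toLinearMap.normDet = 0}ᶜ := by
    ext y
    exact ((fderiv ℝ φ y).toLinearMap.normDet_ne_zero_tfae.out 4 0)
  have h' : MeasurableSet {y | Function.Injective (fderiv ℝ φ y)} := by
    rw [h]
    exact ((continuous_normDet.measurable.comp (measurable_fderiv ℝ φ))
      (measurableSet_singleton 0)).compl
  exact (measurableSet_of_differentiableAt ℝ φ).inter h'

/-- A countably rectifiable set is covered, up to a null set, by countably many injective images
of measurable sets on which the parametrization is differentiable with injective derivative. -/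
lemma IsCountablyRectifiable.exists_cover {E : Set (Eucl n)} (hE : IsCountablyRectifiable d E) :
    ∃ (φ : ℕ → Eucl d → Eucl n) (s : ℕ × ℕ → Set (Eucl d)),
      (∀ i, ∃ K : ℝ≥0, LipschitzWith K (φ i)) ∧ (∀ i, MeasurableSet (s i)) ∧
      (∀ i, ∀ y ∈ s i, DifferentiableAt ℝ (φ i.1) y ∧ Function.Injective (fderiv ℝ (φ i.1) y)) ∧
      (∀ i, InjOn (φ i.1) (s i)) ∧ μHE[d] (E \ ⋃ i, φ i.1 '' s i) = 0 := by
  obtain ⟨φ, hφ, hnull⟩ := hE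
  have hr : ∀ A : Eucl d →L[ℝ] Eucl n, ∃ δ : ℝ≥0, δ ≠ 0 ∧ (Function.Injective A →
      -- Any factor would do in place of `2`: only the lower bound on `‖φ x - φ y‖` is used, to make
      -- `φ` injective on each piece.
      ∀ (v : Eucl d) (w : Eucl n), ‖w - A v‖ ≤ δ * ‖v‖ → ‖A v‖ ≤ (2 : ℝ≥0) * ‖w‖) := by
    intro A
    by_cases hA : Function.Injective A
    · obtain ⟨δ, h1, h2⟩ := exists_approximatesLinearOn_comparable one_lt_two hA
      exact ⟨δ, h1, fun _ v w h => (h2 v w h).2⟩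
    · exact ⟨1, one_ne_zero, fun h => absurd h hA⟩
  choose r hr0 hr using hr
  set I : ℕ → Set (Eucl d) := fun i =>
    {y | DifferentiableAt ℝ (φ i) y ∧ Function.Injective (fderiv ℝ (φ i) y)} with hI
  have hd : ∀ i, ∀ y ∈ I i, HasFDerivWithinAt (φ i) (fderiv ℝ (φ i) y) (I i) y :=
    fun i y hy => hy.1.hasFDerivAt.hasFDerivWithinAt
  choose t A _ hmeas hcov happ hA using fun i =>
    exists_partition_approximatesLinearOn_of_hasFDerivWithinAt (φ i) (I i) (fderiv ℝ (φ i)) (hd i)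
      r hr0
  refine ⟨φ, fun i => I i.1 ∩ t i.1 i.2, hφ, fun i =>
    (measurableSet_injective_fderiv _).inter (hmeas i.1 i.2), fun i y hy => hy.1, ?_, ?_⟩
  · rintro ⟨i, k⟩ x hx y hy hxy
    obtain ⟨z, hz, hAz⟩ := hA i ⟨x, hx.1⟩ k
    have hinj : Function.Injective (A i k) := hAz ▸ hz.2
    have h1 := hr _ hinj (x - y) (φ i x - φ i y) (happ i k x hx y hy)
    have hxy' : φ i x = φ i y := hxy
    rw [hxy', sub_self, norm_zero, mul_zero, norm_le_zero_iff, map_sub, sub_eq_zero] at h1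
    exact hinj h1
  -- The discarded points have null image: those of non-differentiability by Rademacher's theorem
  -- and the Lipschitz bound, the critical ones by the Sard-type statement above.
  · have h1 : ∀ i, μHE[d] (φ i '' {y | ¬ DifferentiableAt ℝ (φ i) y}) = 0 := by
      intro i
      obtain ⟨K, hK⟩ := hφ i
      have h2 : volume {y | ¬ DifferentiableAt ℝ (φ i) y} = 0 := hK.ae_differentiableAt
      refine le_antisymm ((hK.euclideanHausdorffMeasure_image_le _).trans ?_) bot_le
      rw [EuclideanSpace.euclideanHausdorffMeasure_eq_volume, h2, mul_zero]
    have h2 : ∀ i, μHE[d] (φ i '' {y | DifferentiableAt ℝ (φ i) y ∧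
        ¬ Function.Injective (fderiv ℝ (φ i) y)}) = 0 := by
      intro i
      refine euclideanHausdorffMeasure_image_eq_zero_of_not_injective (f' := fderiv ℝ (φ i)) ?_
        (fun x hx => hx.1.hasFDerivAt.hasFDerivWithinAt) fun x hx => hx.2
      have : {y | DifferentiableAt ℝ (φ i) y ∧ ¬ Function.Injective (fderiv ℝ (φ i) y)} =
          {y | DifferentiableAt ℝ (φ i) y} \ I i := by
        ext y
        simp only [hI, mem_ofPred_eq, Set.mem_sdiff]
        tauto
      rw [this]
      exact (measurableSet_of_differentiableAt ℝ (φ i)).diff (measurableSet_injective_fderiv _)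
    refine measure_mono_null ?_ (measure_union_null hnull (measure_union_null
      (measure_iUnion_null h1) (measure_iUnion_null h2)))
    rintro x ⟨hxE, hx⟩
    by_cases hxr : x ∈ ⋃ i, range (φ i)
    · right
      obtain ⟨i, y, rfl⟩ := mem_iUnion.1 hxr
      by_cases hy : DifferentiableAt ℝ (φ i) y
      · by_cases hy' : Function.Injective (fderiv ℝ (φ i) y)
        · exfalso
          obtain ⟨k, hk⟩ := mem_iUnion.1 (hcov i ⟨hy, hy'⟩)
          exact hx (mem_iUnion.2 ⟨(i, k), y, ⟨⟨hy, hy'⟩, hk⟩, rfl⟩)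
        · exact Or.inr (mem_iUnion.2 ⟨i, y, ⟨hy, hy'⟩, rfl⟩)
      · exact Or.inl (mem_iUnion.2 ⟨i, y, hy, rfl⟩)
    · exact Or.inl ⟨hxE, hxr⟩

/-- The Hausdorff measure on the image of a parametrization. -/
lemma restrict_image_eq_map_withDensity {φ : Eucl d → Eucl n} (hφ : Continuous φ)
    {t : Set (Eucl d)} (ht : MeasurableSet t)
    (hd : ∀ y ∈ t, DifferentiableAt ℝ φ y ∧ Function.Injective (fderiv ℝ φ y))
    (hinj : InjOn φ t) :
    (μHE[d] : Measure (Eucl n)).restrict (φ '' t) =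
      ((volume.restrict t).withDensity
        fun y => ENNReal.ofReal (fderiv ℝ φ y).toLinearMap.normDet).map φ := by
  ext B hB
  have hB' : MeasurableSet (φ ⁻¹' B) := hφ.measurable hB
  rw [Measure.restrict_apply hB, Measure.map_apply hφ.measurable hB, withDensity_apply _ hB',
    Measure.restrict_restrict hB', ← image_preimage_inter]
  exact euclideanHausdorffMeasure_image_eq_lintegral_normDet (hB'.inter ht)
    (fun y hy => (hd y hy.2).1.hasFDerivAt.hasFDerivWithinAt) (fun y hy => (hd y hy.2).2)
    (hinj.mono inter_subset_right)

/-- Jacobians multiply under composition when the outer one is taken on the range of the inner map.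
This is where the tangency of the plane field is used. -/
lemma planeJacobian_mul_normDet (L : Eucl n →L[ℝ] Eucl n) (f : Eucl d →L[ℝ] Eucl n) (T : Gr d n)
    (hT : T.1 = f.range) :
    (L ∘L f).toLinearMap.normDet = planeJacobian L T * f.toLinearMap.normDet := by
  obtain ⟨T, hTd⟩ := T
  subst hT
  exact LinearMap.normDet_comp _ _

end Rectifiable

/-- A smooth diffeomorphism of `ℝⁿ` that is Lipschitz together with its inverse. -/
structure LipDiffeo (n : ℕ) where
  toHomeomorph : Eucl n ≃ₜ Eucl n
  exists_lipschitz : ∃ K : ℝ≥0, LipschitzWith K toHomeomorph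
  exists_lipschitz_symm : ∃ K : ℝ≥0, LipschitzWith K toHomeomorph.symm
  contDiff : ContDiff ℝ (⊤ : ℕ∞) toHomeomorph
  injective_fderiv : ∀ x, Function.Injective (fderiv ℝ toHomeomorph x)

namespace LipDiffeo

variable {d n : ℕ} (f : LipDiffeo n)

/-- The derivative of a diffeomorphism. -/
def deriv (x : Eucl n) : Eucl n →L[ℝ] Eucl n := fderiv ℝ f.toHomeomorph x

lemma injective_deriv (x : Eucl n) : Function.Injective (f.deriv x) := f.injective_fderiv x

lemma differentiable : Differentiable ℝ f.toHomeomorph :=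
  f.contDiff.differentiable (by simp)

lemma hasFDerivAt (x : Eucl n) : HasFDerivAt f.toHomeomorph (f.deriv x) x :=
  (f.differentiable x).hasFDerivAt

lemma continuous_deriv : Continuous f.deriv := f.contDiff.continuous_fderiv (by simp)

/-- The tangential Jacobian along a plane field. -/
def jacobian (P : Eucl n → Gr d n) (x : Eucl n) : ℝ≥0∞ :=
  ENNReal.ofReal (planeJacobian (f.deriv x) (P x))

lemma measurable_planeJacobian_deriv :
    Measurable fun p : Eucl n × Gr d n => ENNReal.ofReal (planeJacobian (f.deriv p.1) p.2) := by
  have h : Continuous fun p : Eucl n × Gr d n => planeJacobian (f.deriv p.1) p.2 :=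
    Continuous.comp (f := fun p : Eucl n × Gr d n => (f.deriv p.1, p.2))
      continuous_planeJacobian ((f.continuous_deriv.comp continuous_fst).prodMk continuous_snd)
  exact (ENNReal.continuous_ofReal.comp h).measurable

lemma aemeasurable_jacobian {P : Eucl n → Gr d n} {μ : Measure (Eucl n)} (hP : AEMeasurable P μ) :
    AEMeasurable (f.jacobian P) μ :=
  Measurable.comp_aemeasurable (f := fun x => (x, P x)) f.measurable_planeJacobian_deriv
    (aemeasurable_id.prodMk hP)

/-- The tangential change of variables formula on a piece of a parametrized set. -/
lemma euclideanHausdorffMeasure_image_eq_lintegral_of_subset_param {E M : Set (Eucl n)}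
    {P : Eucl n → Gr d n} (hP : AEMeasurable P (μHE[d].restrict E)) (hT : IsTangentField E P)
    {φ : Eucl d → Eucl n} (hφ : ∃ K : ℝ≥0, LipschitzWith K φ) {s : Set (Eucl d)}
    (hs : MeasurableSet s)
    (hd : ∀ y ∈ s, DifferentiableAt ℝ φ y ∧ Function.Injective (fderiv ℝ φ y))
    (hinj : InjOn φ s) (hM : MeasurableSet M) (hME : M ⊆ E) (hMs : M ⊆ φ '' s) :
    μHE[d] (f.toHomeomorph '' M) = ∫⁻ x in M, f.jacobian P x ∂μHE[d] := by
  have hφc : Continuous φ := hφ.choose_spec.continuous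
  set t := φ ⁻¹' M ∩ s with ht
  have htm : MeasurableSet t := (hφc.measurable hM).inter hs
  have hts : t ⊆ s := inter_subset_right
  have hMt : M = φ '' t := by rw [ht, image_preimage_inter, inter_eq_left.2 hMs]
  have hcomp : ∀ y ∈ t, HasFDerivWithinAt (f.toHomeomorph ∘ φ)
      (f.deriv (φ y) ∘L fderiv ℝ φ y) t y := fun y hy =>
    ((f.hasFDerivAt (φ y)).comp y (hd y hy.2).1.hasFDerivAt).hasFDerivWithinAt
  have hPM : AEMeasurable (f.jacobian P) (μHE[d].restrict M) :=
    f.aemeasurable_jacobian (hP.mono_measure (Measure.restrict_mono hME le_rfl))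
  have hr := restrict_image_eq_map_withDensity hφc htm (fun y hy => hd y hy.2) (hinj.mono hts)
  rw [← hMt] at hr
  have hmJ : Measurable fun y => ENNReal.ofReal (fderiv ℝ φ y).toLinearMap.normDet :=
    ENNReal.measurable_ofReal.comp (continuous_normDet.measurable.comp (measurable_fderiv ℝ φ))
  -- Both sides become integrals over `t`, by the area formula for `f ∘ φ` on the left and for `φ`
  -- on the right. The integrands agree by the chain rule for Jacobians.
  conv_lhs => rw [hMt, ← image_comp]
  rw [euclideanHausdorffMeasure_image_eq_lintegral_normDet htm hcomp
    (fun y hy => (f.injective_deriv _).comp (hd y hy.2).2)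
    (f.toHomeomorph.injective.injOn.comp (hinj.mono hts) (mapsTo_univ _ _))]
  rw [hr] at hPM ⊢
  rw [lintegral_map' hPM hφc.aemeasurable,
    lintegral_withDensity_eq_lintegral_mul_non_measurable₀ _ hmJ.aemeasurable
      (ae_of_all _ fun y => ENNReal.ofReal_lt_top)]
  refine lintegral_congr_ae ?_
  filter_upwards [ae_restrict_mem htm, ae_restrict_of_ae (hT φ hφ)] with y hy hTy
  rw [planeJacobian_mul_normDet _ _ (P (φ y)) (hTy (hME hy.1) (hd y hy.2).1 (hd y hy.2).2),
    ENNReal.ofReal_mul (planeJacobian_nonneg _ _), mul_comm]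
  rfl

lemma measure_image_eq_zero {N : Set (Eucl n)} (hN : μHE[d] N = 0) :
    μHE[d] (f.toHomeomorph '' N) = 0 := by
  obtain ⟨K, hK⟩ := f.exists_lipschitz
  refine le_antisymm ((hK.euclideanHausdorffMeasure_image_le N).trans ?_) bot_le
  rw [hN, mul_zero]

lemma quasiMeasurePreserving_symm :
    Measure.QuasiMeasurePreserving f.toHomeomorph.symm
      (μHE[d] : Measure (Eucl n)) (μHE[d] : Measure (Eucl n)) := by
  refine ⟨f.toHomeomorph.symm.continuous.measurable, Measure.AbsolutelyContinuous.mk ?_⟩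
  intro N hN h0
  rw [Measure.map_apply f.toHomeomorph.symm.continuous.measurable hN,
    ← f.toHomeomorph.image_eq_preimage_symm]
  exact f.measure_image_eq_zero h0

lemma nullMeasurableSet_image {E : Set (Eucl n)} (hE : NullMeasurableSet E μHE[d]) :
    NullMeasurableSet (f.toHomeomorph '' E) μHE[d] := by
  rw [f.toHomeomorph.image_eq_preimage_symm]
  exact hE.preimage f.quasiMeasurePreserving_symm

/-- The tangential change of variables formula for a rectifiable set. -/
theorem restrict_image_eq {E : Set (Eucl n)} (hE : NullMeasurableSet E μHE[d])
    (hrect : IsCountablyRectifiable d E) {P : Eucl n → Gr d n}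
    (hP : AEMeasurable P (μHE[d].restrict E)) (hT : IsTangentField E P) :
    μHE[d].restrict (f.toHomeomorph '' E) =
      ((μHE[d].restrict E).withDensity (f.jacobian P)).map f.toHomeomorph := by
  obtain ⟨E', hE'E, hE', hEE'⟩ := hE.exists_measurable_subset_ae_eq
  have himg : (f.toHomeomorph '' E' : Set (Eucl n)) =ᵐ[μHE[d]] f.toHomeomorph '' E := by
    refine (ae_eq_set.2 ⟨?_, ?_⟩)
    · rw [sdiff_eq_empty.2 (image_mono hE'E), measure_empty]
    · rw [← image_sdiff f.toHomeomorph.injective]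
      exact f.measure_image_eq_zero (ae_eq_set.1 hEE').2
  rw [← Measure.restrict_congr_set himg, ← Measure.restrict_congr_set hEE']
  obtain ⟨φ, s, hφ, hs, hd, hinj, hnull⟩ := hrect.exists_cover
  have hC : ∀ i, MeasurableSet (φ i.1 '' s i) := fun i =>
    (hs i).image_of_continuousOn_injOn ((hφ i.1).choose_spec.continuous.continuousOn) (hinj i)
  set N := (⋃ i, φ i.1 '' s i)ᶜ with hN
  have hNm : MeasurableSet N := (MeasurableSet.iUnion hC).compl
  have hEN : μHE[d] (E' ∩ N) = 0 := by
    refine measure_mono_null ?_ hnull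
    exact fun x hx => ⟨hE'E hx.1, hx.2⟩
  have hmeas : Measurable f.toHomeomorph := f.toHomeomorph.continuous.measurable
  -- It suffices that the two measures agree on each member of a countable cover, so the pieces `C`
  -- need not be disjoint. The cover consists of the parametrized pieces and the remainder `N`,
  -- which meets `E'` in a null set.
  have key : ∀ C : Set (Eucl n), MeasurableSet C →
      (∀ B, MeasurableSet B → μHE[d] (f.toHomeomorph '' (E' ∩ (B ∩ C))) =
        ∫⁻ x in E' ∩ (B ∩ C), f.jacobian P x ∂μHE[d]) →
      (μHE[d].restrict (f.toHomeomorph '' E')).restrict (f.toHomeomorph '' C) =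
      (((μHE[d].restrict E').withDensity (f.jacobian P)).map f.toHomeomorph).restrict
        (f.toHomeomorph '' C) := by
    intro C hC h
    have hfC : MeasurableSet (f.toHomeomorph '' C) := by
      rw [f.toHomeomorph.image_eq_preimage_symm]
      exact f.toHomeomorph.symm.continuous.measurable hC
    ext B hB
    have h1 := h _ (hmeas hB)
    rw [Measure.restrict_apply hB, Measure.restrict_apply hB,
      Measure.restrict_apply (hB.inter hfC), Measure.map_apply hmeas (hB.inter hfC),
      preimage_inter, preimage_image_eq _ f.toHomeomorph.injective,
      withDensity_apply _ ((hmeas hB).inter hC),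
      Measure.restrict_restrict ((hmeas hB).inter hC), inter_comm _ E', ← h1,
      image_inter f.toHomeomorph.injective, image_preimage_inter, inter_comm]
  have hcov : (⋃ o : Option (ℕ × ℕ), f.toHomeomorph ''
      (o.elim N fun i => φ i.1 '' s i)) = univ := by
    rw [← image_iUnion, iUnion_option]
    change f.toHomeomorph '' (N ∪ ⋃ i, φ i.1 '' s i) = univ
    rw [hN, compl_union_self, image_univ, f.toHomeomorph.surjective.range_eq]
  refine (Measure.ext_iff_of_iUnion_eq_univ hcov).2 ?_
  rintro (_ | i)
  · refine key _ hNm fun B hB => ?_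
    have h0 : μHE[d] (E' ∩ (B ∩ N)) = 0 :=
      measure_mono_null (by gcongr; exact inter_subset_right) hEN
    change μHE[d] (f.toHomeomorph '' (E' ∩ (B ∩ N))) =
      ∫⁻ x in E' ∩ (B ∩ N), f.jacobian P x ∂μHE[d]
    rw [f.measure_image_eq_zero h0, Measure.restrict_eq_zero.2 h0, lintegral_zero_measure]
  · refine key _ (hC i) fun B hB => ?_
    exact f.euclideanHausdorffMeasure_image_eq_lintegral_of_subset_param hP hT (hφ i.1) (hs i)
      (hd i) (hinj i) (hE'.inter (hB.inter (hC i))) (inter_subset_left.trans hE'E)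
      (inter_subset_right.trans inter_subset_right)

end LipDiffeo

/-! ### Pull-back of forms and push-forward of currents -/

/-- Precomposition is linear in the form and multilinear in the linear maps. Alternating maps are
treated as multilinear ones and recovered by a linear left inverse `ρ`, continuous by finite
dimension. -/
lemma contDiff_compContinuousLinearMap {m n : ℕ} {r : WithTop ℕ∞}
    {ω : Eucl n → Eucl n [⋀^Fin m]→L[ℝ] ℝ} {g : Eucl n → Eucl n →L[ℝ] Eucl n}
    (hω : ContDiff ℝ r ω) (hg : ContDiff ℝ r g) :
    ContDiff ℝ r fun x => (ω x).compContinuousLinearMap (g x) := by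
  have hfin : FiniteDimensional ℝ
      (ContinuousMultilinearMap ℝ (fun _ : Fin m => Eucl n) ℝ) :=
    FiniteDimensional.of_injective
      (ContinuousMultilinearMap.toMultilinearMapLinear (R' := ℝ) (A := ℝ)
        (M₁ := fun _ : Fin m => Eucl n) (M₂ := ℝ))
      ContinuousMultilinearMap.toMultilinearMap_injective
  let ι := ContinuousAlternatingMap.toContinuousMultilinearMapCLM (E := Eucl n) (F := ℝ)
    (ι := Fin m) (𝕜 := ℝ) ℝ
  obtain ⟨ρ, hρ⟩ := ι.toLinearMap.exists_leftInverse_of_injective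
    (LinearMap.ker_eq_bot.2 ContinuousAlternatingMap.toContinuousMultilinearMap_injective)
  have h1 : (fun x => (ω x).compContinuousLinearMap (g x)) = fun x =>
      ρ.toContinuousLinearMap
        (ContinuousMultilinearMap.compContinuousLinearMapContinuousMultilinear ℝ
          (fun _ : Fin m => Eucl n) (fun _ => Eucl n) ℝ (fun _ => g x) (ι (ω x))) := by
    ext1 x
    have h2 := LinearMap.congr_fun hρ ((ω x).compContinuousLinearMap (g x))
    exact h2.symm
  rw [h1]
  refine ρ.toContinuousLinearMap.contDiff.comp (ContDiff.clm_apply ?_ (ι.contDiff.comp hω))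
  exact (ContinuousMultilinearMap.contDiff _).comp (contDiff_pi.2 fun _ => hg)

namespace LipDiffeo

variable {d n : ℕ} (f : LipDiffeo n)

lemma contDiff_deriv : ContDiff ℝ (⊤ : ℕ∞) f.deriv :=
  f.contDiff.fderiv_right (by simp)

/-- The pull-back of a test form. -/
def pullback {m : ℕ} (τ : TestForm m n) : TestForm m n where
  toFun x := (τ (f.toHomeomorph x)).compContinuousLinearMap (f.deriv x)
  contDiff' := contDiff_compContinuousLinearMap (τ.contDiff.comp f.contDiff) f.contDiff_deriv
  hasCompactSupport' := by
    refine (τ.hasCompactSupport.comp_homeomorph f.toHomeomorph).mono' ?_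
    refine Function.support_subset_iff'.2 fun x hx => ?_
    have hx' : τ (f.toHomeomorph x) = 0 :=
      image_eq_zero_of_notMem_tsupport (f := τ ∘ f.toHomeomorph) hx
    rw [hx']
    rfl
  tsupport_subset' := by simp

lemma pullback_apply {m : ℕ} (τ : TestForm m n) (x : Eucl n) :
    f.pullback τ x = (τ (f.toHomeomorph x)).compContinuousLinearMap (f.deriv x) := rfl

lemma dTest_pullback {m : ℕ} (τ : TestForm m n) :
    dTest m n (f.pullback τ) = f.pullback (dTest m n τ) := by
  ext1 x
  rw [dTest_apply, pullback_apply, dTest_apply]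
  exact extDeriv_pullback (r := (⊤ : ℕ∞)) (τ.contDiff.differentiable (by simp)).differentiableAt
    f.contDiff.contDiffAt (by
      rw [minSmoothness_of_isRCLikeNormedField]
      exact WithTop.coe_le_coe.2 (le_top : (2 : ℕ∞) ≤ ⊤))

/-! ### Push-forward of a rectifiable current. -/

section Push

variable (A : RectifiableCurrent d n)

/-- The tangent plane field of a rectifiable current. -/
def _root_.Aniso.RectifiableCurrent.plane (A : RectifiableCurrent d n) (x : Eucl n) : Gr d n :=
  (A.orient x).forget

lemma _root_.Aniso.RectifiableCurrent.aemeasurable_plane :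
    AEMeasurable A.plane (μHE[d].restrict A.carrier) :=
  OrientedGr.continuous_forget.measurable.comp_aemeasurable A.aemeasurable_orient

lemma restrict_image_carrier :
    μHE[d].restrict (f.toHomeomorph '' A.carrier) =
      ((μHE[d].restrict A.carrier).withDensity (f.jacobian A.plane)).map f.toHomeomorph :=
  f.restrict_image_eq A.nullMeasurableSet_carrier A.rectifiable A.aemeasurable_plane A.tangent

lemma lintegral_image_carrier (u : Eucl n → ℝ≥0∞) :
    ∫⁻ y in f.toHomeomorph '' A.carrier, u y ∂μHE[d] =
      ∫⁻ x in A.carrier, f.jacobian A.plane x * u (f.toHomeomorph x) ∂μHE[d] := by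
  rw [restrict_image_carrier, f.toHomeomorph.measurableEmbedding.lintegral_map,
    lintegral_withDensity_eq_lintegral_mul_non_measurable₀ _
      (f.aemeasurable_jacobian A.aemeasurable_plane) (ae_of_all _ fun y => ENNReal.ofReal_lt_top)]
  rfl

lemma integral_image_carrier (u : Eucl n → ℝ) :
    ∫ y in f.toHomeomorph '' A.carrier, u y ∂μHE[d] =
      ∫ x in A.carrier, planeJacobian (f.deriv x) (A.plane x) * u (f.toHomeomorph x) ∂μHE[d] := by
  rw [restrict_image_carrier, f.toHomeomorph.measurableEmbedding.integral_map,
    integral_withDensity_eq_integral_toReal_smul₀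
      (f.aemeasurable_jacobian A.aemeasurable_plane) (ae_of_all _ fun y => ENNReal.ofReal_lt_top)]
  simp only [jacobian, ENNReal.toReal_ofReal (planeJacobian_nonneg _ _), smul_eq_mul]

/-- A continuous function on the product of a closed ball of linear maps and the compact
Grassmannian is bounded. This keeps the mass of the push-forward finite. -/
lemma exists_planeJacobian_le :
    ∃ C : ℝ, ∀ (x : Eucl n) (T : Gr d n), planeJacobian (f.deriv x) T ≤ C := by
  obtain ⟨K, hK⟩ := f.exists_lipschitz
  have : ProperSpace (Eucl n →L[ℝ] Eucl n) := FiniteDimensional.proper_real _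
  obtain ⟨C, hC⟩ := ((isCompact_closedBall (0 : Eucl n →L[ℝ] Eucl n) K).prod
    (isCompact_univ (X := Gr d n))).bddAbove_image continuous_planeJacobian.continuousOn
  refine ⟨C, fun x T => hC ⟨(f.deriv x, T), ⟨?_, mem_univ _⟩, rfl⟩⟩
  rw [mem_closedBall_zero_iff]
  exact norm_fderiv_le_of_lipschitz ℝ hK

lemma aemeasurable_image_carrier_iff {Y : Type*} [MeasurableSpace Y] {u : Eucl n → Y}
    (hu : AEMeasurable (fun x => u (f.toHomeomorph x)) (μHE[d].restrict A.carrier)) :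
    AEMeasurable u (μHE[d].restrict (f.toHomeomorph '' A.carrier)) := by
  rw [restrict_image_carrier, f.toHomeomorph.measurableEmbedding.aemeasurable_map_iff]
  exact hu.mono_ac (withDensity_absolutelyContinuous _ _)

/-- The push-forward of a rectifiable current. -/
def push : RectifiableCurrent d n where
  carrier := f.toHomeomorph '' A.carrier
  orient y := (A.orient (f.toHomeomorph.symm y)).map (f.deriv (f.toHomeomorph.symm y))
    (f.injective_deriv _)
  mult y := A.mult (f.toHomeomorph.symm y)
  nullMeasurableSet_carrier := f.nullMeasurableSet_image A.nullMeasurableSet_carrier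
  rectifiable := by
    obtain ⟨φ, hφ, hnull⟩ := A.rectifiable
    obtain ⟨K, hK⟩ := f.exists_lipschitz
    refine ⟨fun i => f.toHomeomorph ∘ φ i, fun i => ?_, ?_⟩
    · obtain ⟨K', hK'⟩ := hφ i
      exact ⟨K * K', hK.comp hK'⟩
    · refine measure_mono_null ?_ (f.measure_image_eq_zero hnull)
      simp only [range_comp]
      rw [← image_iUnion, ← image_sdiff f.toHomeomorph.injective]
  aemeasurable_orient := by
    apply f.aemeasurable_image_carrier_iff A
    simp only [Homeomorph.symm_apply_apply]
    exact Measurable.comp_aemeasurable (f := fun x => (x, A.orient x))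
      (OrientedGr.continuous_map f.continuous_deriv f.injective_deriv).measurable
      (aemeasurable_id.prodMk A.aemeasurable_orient)
  aemeasurable_mult := by
    apply f.aemeasurable_image_carrier_iff A
    simpa only [Homeomorph.symm_apply_apply] using A.aemeasurable_mult
  mass_lt_top := by
    obtain ⟨C, hC⟩ := f.exists_planeJacobian_le (d := d)
    rw [f.lintegral_image_carrier A]
    simp only [Homeomorph.symm_apply_apply]
    calc ∫⁻ x in A.carrier, f.jacobian A.plane x * A.mult x ∂μHE[d]
        ≤ ∫⁻ x in A.carrier, ENNReal.ofReal C * A.mult x ∂μHE[d] := by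
          refine lintegral_mono fun x => ?_
          gcongr
          exact ENNReal.ofReal_le_ofReal (hC _ _)
      _ = ENNReal.ofReal C * ∫⁻ x in A.carrier, A.mult x ∂μHE[d] :=
          lintegral_const_mul' _ _ ENNReal.ofReal_ne_top
      _ < ∞ := ENNReal.mul_lt_top ENNReal.ofReal_lt_top A.mass_lt_top
  tangent := by
    rintro h ⟨K, hK⟩
    obtain ⟨K', hK'⟩ := f.exists_lipschitz_symm
    have hlip : LipschitzWith (K' * K) (f.toHomeomorph.symm ∘ h) := hK'.comp hK
    -- A Lipschitz map `h` meeting the image is tested through `f⁻¹ ∘ h`, which is Lipschitz and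
    -- hence differentiable almost everywhere by Rademacher's theorem.
    filter_upwards [A.tangent _ ⟨_, hlip⟩, hlip.ae_differentiableAt] with y hy hdy hyE hd hinj
    have hcomp : fderiv ℝ h y =
        (f.deriv (f.toHomeomorph.symm (h y))) ∘L fderiv ℝ (f.toHomeomorph.symm ∘ h) y := by
      have h1 := (f.hasFDerivAt (f.toHomeomorph.symm (h y))).comp y hdy.hasFDerivAt
      have h2 : f.toHomeomorph ∘ (f.toHomeomorph.symm ∘ h) = h := by
        ext1 z
        simp
      rw [h2] at h1
      exact h1.fderiv
    have hmem : (f.toHomeomorph.symm ∘ h) y ∈ A.carrier := by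
      obtain ⟨x, hx, hxy⟩ := hyE
      rw [Function.comp_apply, ← hxy, Homeomorph.symm_apply_apply]
      exact hx
    have hinj' : Function.Injective (fderiv ℝ (f.toHomeomorph.symm ∘ h) y) := by
      rw [hcomp] at hinj
      exact Function.Injective.of_comp hinj
    rw [OrientedGr.forget_map, Gr.map_coe (f.injective_deriv _)]
    have h3 := hy hmem hdy hinj'
    simp only [Function.comp_apply] at h3
    rw [h3, hcomp]
    exact (LinearMap.range_comp _ _).symm

lemma toCurrent_push (τ : TestForm d n) :
    (f.push A).toCurrent τ = A.toCurrent (f.pullback τ) := by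
  rw [RectifiableCurrent.toCurrent_apply, RectifiableCurrent.toCurrent_apply]
  refine (f.integral_image_carrier A _).trans (integral_congr_ae (ae_of_all _ fun x => ?_))
  simp only [push, Homeomorph.symm_apply_apply]
  rw [pullback_apply, ← planeJacobian_mul_pairing_map _ _ (f.injective_deriv x)]
  simp only [RectifiableCurrent.plane]
  ring

lemma energy_push (Ψ : Gr d n → ℝ) :
    (f.push A).energy Ψ = ∫⁻ x in A.carrier, A.mult x *
      (ENNReal.ofReal (planeJacobian (f.deriv x) (A.plane x)) *
        ENNReal.ofReal (Ψ (Gr.map (f.deriv x) (A.plane x)))) ∂μHE[d] := by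
  refine (f.lintegral_image_carrier A _).trans (lintegral_congr fun x => ?_)
  simp only [push, Homeomorph.symm_apply_apply, OrientedGr.forget_map, jacobian]
  rw [mul_left_comm]
  rfl

end Push

lemma boundary_push {k : ℕ} (A : RectifiableCurrent (k + 1) n) (τ : TestForm k n) :
    boundary (f.push A).toCurrent τ = boundary A.toCurrent (f.pullback τ) := by
  change (f.push A).toCurrent (dTest k n τ) = A.toCurrent (dTest k n (f.pullback τ))
  rw [toCurrent_push, dTest_pullback]

end LipDiffeo

open scoped Manifold in
/-- A current vanishes on the test forms supported off its support. -/
lemma Current.eq_zero_of_tsupport_subset {m n : ℕ} (S : Current m n) (τ : TestForm m n)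
    (h : tsupport τ ⊆ (Distribution.dsupport S)ᶜ) : S τ = 0 := by
  have hloc : ∀ x : tsupport τ, ∃ U : Set (Eucl n), Distribution.IsVanishingOn S U ∧ IsOpen U ∧
      (x : Eucl n) ∈ U := fun x => (Distribution.notMem_dsupport_iff _).1 (h x.2)
  choose U hUS hUo hxU using hloc
  -- `S` is only known to vanish locally. A smooth partition of unity splits `τ` into finitely many
  -- forms, its support being compact, each supported where `S` vanishes.
  obtain ⟨ρ, hρ⟩ := SmoothPartitionOfUnity.exists_isSubordinate 𝓘(ℝ, Eucl n)
    (isClosed_tsupport τ) U hUo fun x hx => mem_iUnion.2 ⟨⟨x, hx⟩, hxU ⟨x, hx⟩⟩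
  have hcpt : IsCompact (tsupport τ) := τ.hasCompactSupport
  set I := (ρ.locallyFinite.finite_nonempty_inter_compact hcpt).toFinset with hI
  have hsupp : ∀ i, tsupport (fun x => ρ i x • τ x) ⊆ tsupport τ := fun i =>
    closure_mono (Function.support_smul_subset_right (ρ i) τ)
  let σ : tsupport τ → TestForm m n := fun i =>
    { toFun := fun x => ρ i x • τ x
      contDiff' := (ρ i).contMDiff.contDiff.smul τ.contDiff
      hasCompactSupport' := hcpt.of_isClosed_subset (isClosed_tsupport _) (hsupp i)
      tsupport_subset' := by simp }
  have hσ : τ = ∑ i ∈ I, σ i := by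
    ext1 x
    have hsum : (∑ i ∈ I, σ i) x = ∑ i ∈ I, ρ i x • τ x := by
      rw [sum_apply]
      rfl
    rw [hsum, ← Finset.sum_smul]
    by_cases hx : x ∈ tsupport τ
    · have h1 : ∑ i ∈ I, ρ i x = 1 := by
        rw [← ρ.sum_eq_one hx]
        refine (finsum_eq_sum_of_support_subset _ fun i hi => ?_).symm
        simp only [hI, Finite.coe_toFinset, mem_ofPred_eq]
        exact ⟨x, hi, hx⟩
      rw [h1, one_smul]
    · rw [image_eq_zero_of_notMem_tsupport hx, smul_zero]
  rw [hσ, map_sum]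
  refine Finset.sum_eq_zero fun i _ => hUS i (σ i) ?_
  exact (closure_mono (Function.support_smul_subset_left (ρ i) τ)).trans (hρ i)

/-! ### Deformations along a vector field -/

section Deformation

variable {d n : ℕ}

lemma injective_of_norm_sub_one_le {L : Eucl n →L[ℝ] Eucl n} (hL : ‖L - 1‖ ≤ 1 / 2) :
    Function.Injective L := by
  refine (injective_iff_map_eq_zero L).2 fun v hv => ?_
  have h1 := (L - 1).le_of_opNorm_le hL v
  simp only [FunLike.coe_sub, Pi.sub_apply, hv, zero_sub, norm_neg,
    one_apply_eq_self] at h1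
  exact norm_le_zero_iff.1 (by linarith)

lemma hasFDerivAt_id_add_smul {g : Eucl n → Eucl n} (hg : Differentiable ℝ g) (ε : ℝ)
    (x : Eucl n) :
    HasFDerivAt (fun x => x + ε • g x) (1 + ε • fderiv ℝ g x) x :=
  (hasFDerivAt_id x).add ((hg x).hasFDerivAt.const_smul ε)

/-- A small deformation of the identity along a Lipschitz vector field. -/
lemma exists_lipDiffeo {g : Eucl n → Eucl n} (hg : ContDiff ℝ (⊤ : ℕ∞) g) {C : ℝ≥0}
    (hC : LipschitzWith C g) {ε : ℝ} (hε : |ε| * C ≤ 1 / 2) :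
    ∃ f : LipDiffeo n, ⇑f.toHomeomorph = fun x => x + ε • g x := by
  have hdiff : Differentiable ℝ g := hg.differentiable (by simp)
  have hsmul : ∀ x y, ‖ε • g x - ε • g y‖ ≤ 1 / 2 * ‖x - y‖ := by
    intro x y
    rw [← smul_sub, norm_smul, Real.norm_eq_abs]
    calc |ε| * ‖g x - g y‖ ≤ |ε| * (C * ‖x - y‖) := by gcongr; exact hC.norm_sub_le x y
      _ = |ε| * C * ‖x - y‖ := by ring
      _ ≤ 1 / 2 * ‖x - y‖ := by gcongr
  have happ : ApproximatesLinearOn (fun x => x + ε • g x)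
      (ContinuousLinearEquiv.refl ℝ (Eucl n) : Eucl n →L[ℝ] Eucl n) univ (1 / 2) := by
    intro x _ y _
    have h1 : x + ε • g x - (y + ε • g y) -
        (ContinuousLinearEquiv.refl ℝ (Eucl n) : Eucl n →L[ℝ] Eucl n) (x - y) =
        ε • g x - ε • g y := by
      simp only [ContinuousLinearEquiv.coe_refl, ContinuousLinearMap.id_apply]
      abel
    rw [h1]
    simpa using hsmul x y
  -- The perturbation constant `1/2` must lie below `‖id⁻¹‖⁻¹`, which is `1` except on the zero
  -- space.
  have hcond : Subsingleton (Eucl n) ∨ (1 / 2 : ℝ≥0) <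
      ‖((ContinuousLinearEquiv.refl ℝ (Eucl n)).symm : Eucl n →L[ℝ] Eucl n)‖₊⁻¹ := by
    rcases subsingleton_or_nontrivial (Eucl n) with h | h
    · exact Or.inl h
    · right
      have : ‖((ContinuousLinearEquiv.refl ℝ (Eucl n)).symm : Eucl n →L[ℝ] Eucl n)‖₊ = 1 := by
        ext
        exact ContinuousLinearMap.norm_id
      rw [this, inv_one]
      exact NNReal.half_lt_self one_ne_zero
  let e := happ.toHomeomorph _ hcond
  have he : ⇑e = fun x => x + ε • g x := rfl
  have hanti : AntilipschitzWith 2 e := by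
    refine AntilipschitzWith.of_le_mul_dist fun x y => ?_
    rw [he, dist_eq_norm, dist_eq_norm]
    have h1 := hsmul x y
    have h2 : ‖x - y‖ ≤ ‖x + ε • g x - (y + ε • g y)‖ + ‖ε • g x - ε • g y‖ := by
      have := norm_sub_le (x + ε • g x - (y + ε • g y)) (ε • g x - ε • g y)
      rwa [show x + ε • g x - (y + ε • g y) - (ε • g x - ε • g y) = x - y by abel] at this
    push_cast
    linarith
  refine ⟨⟨e, ⟨1 + ‖ε‖₊ * C, ?_⟩, ⟨2, hanti.to_rightInverse e.apply_symm_apply⟩, ?_, ?_⟩, he⟩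
  · rw [he]
    exact LipschitzWith.id.add (lipschitzWith_smul ε |>.comp hC)
  · rw [he]
    exact contDiff_id.add (contDiff_const.fun_smul hg)
  · intro x
    rw [he, (hasFDerivAt_id_add_smul hdiff ε x).fderiv]
    refine injective_of_norm_sub_one_le ?_
    rw [add_sub_cancel_left, norm_smul, Real.norm_eq_abs]
    exact (mul_le_mul_of_nonneg_left (norm_fderiv_le_of_lipschitz ℝ hC) (abs_nonneg _)).trans hε

/-- Off the closed set `K` the map is the identity near each point, so its derivative is the
identity there. Hence `f^* τ - τ` is supported in `K`, and `S` vanishes on it. -/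
lemma LipDiffeo.boundary_push_eq {k : ℕ} (f : LipDiffeo n) (A : RectifiableCurrent (k + 1) n)
    {S : Current k n} (hA : boundary A.toCurrent = S) {K : Set (Eucl n)} (hK : IsClosed K)
    (hKS : K ⊆ (Distribution.dsupport S)ᶜ) (hf : ∀ x ∉ K, f.toHomeomorph x = x) :
    boundary (f.push A).toCurrent = S := by
  ext τ
  rw [boundary_push, hA, ← sub_eq_zero, ← map_sub]
  refine S.eq_zero_of_tsupport_subset _ (subset_trans ?_ hKS)
  refine closure_minimal (Function.support_subset_iff'.2 fun x hx => ?_) hK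
  have h1 : f.toHomeomorph =ᶠ[𝓝 x] id := by
    filter_upwards [hK.isOpen_compl.mem_nhds hx] with y hy using hf y hy
  have h2 : f.deriv x = ContinuousLinearMap.id ℝ (Eucl n) := by
    rw [LipDiffeo.deriv, h1.fderiv_eq, fderiv_id]
  rw [sub_apply, f.pullback_apply, h2, hf x hx]
  ext v
  simp

end Deformation

/-! ### The energy density of a deformed plane -/

section Density

variable {d n : ℕ}

/-- The density of the energy of the image of the plane `T` under `L`. -/
def imageDensity (Ψ : Gr d n → ℝ) (L : Eucl n →L[ℝ] Eucl n) (T : Gr d n) : ℝ :=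
  planeJacobian L T * Ψ (Gr.map L T)

/-- The extension of an integrand to frames that is homogeneous with respect to the volume. -/
def frameDensity (Ψ : Gr d n → ℝ) (w : Fin d → Eucl n) : ℝ :=
  √(Matrix.gram ℝ w).det * onFrames Ψ w

/-- For a fixed frame `v` of `T`, the dependence on `L` passes through the vectors `L (v i)`.
Calculus on the Grassmannian becomes calculus of one `C¹` function on an open set of frames. -/
lemma imageDensity_plane (Ψ : Gr d n → ℝ) {L : Eucl n →L[ℝ] Eucl n} (hL : Function.Injective L)
    (v : OrthoFrame d n) : imageDensity Ψ L v.plane = frameDensity Ψ fun i => L (v.1 i) := by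
  have hli : LinearIndependent ℝ fun i => L (v.1 i) :=
    v.2.linearIndependent.map' L.toLinearMap (LinearMap.ker_eq_bot.2 hL)
  rw [imageDensity, frameDensity, planeJacobian_plane, onFrames_of_linearIndependent Ψ hli]
  congr 2
  apply Subtype.ext
  rw [Gr.map_coe hL]
  change Submodule.map L.toLinearMap (Submodule.span ℝ (range v.1)) =
    Submodule.span ℝ (range fun i => L (v.1 i))
  rw [← Submodule.span_image, ← range_comp]
  rfl

lemma imageDensity_one (Ψ : Gr d n → ℝ) (T : Gr d n) : imageDensity Ψ 1 T = Ψ T := by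
  have h : Gr.map 1 T = T := by
    apply Subtype.ext
    rw [Gr.map_coe Function.injective_id]
    exact Submodule.map_id _
  rw [imageDensity, h, planeJacobian]
  have h1 : ((1 : Eucl n →L[ℝ] Eucl n).toLinearMap.comp T.1.subtype) = T.1.subtype := rfl
  rw [h1, LinearMap.normDet_subtype, one_mul]

lemma IsC1Integrand.contDiffOn_frameDensity {Ψ : Gr d n → ℝ} (hΨ : IsC1Integrand Ψ) :
    ContDiffOn ℝ 1 (frameDensity Ψ) {w | LinearIndependent ℝ w} := by
  have hgram : ContDiff ℝ 1 fun w : Fin d → Eucl n => (Matrix.gram ℝ w).det := by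
    simp only [Matrix.det_apply, Matrix.gram_apply]
    refine ContDiff.sum fun σ _ => ContDiff.const_smul _ (contDiff_prod fun i _ => ?_)
    exact (contDiff_apply ℝ (Eucl n) _).inner ℝ (contDiff_apply ℝ (Eucl n) _)
  refine ContDiffOn.mul (fun w hw => ?_) hΨ.contDiffOn
  exact (hgram.contDiffAt.sqrt
    ((Matrix.det_gram_ne_zero_iff_linearIndependent (𝕜 := ℝ)).2 hw)).contDiffWithinAt

lemma hasFDerivAt_comp_frame {h : (Fin d → Eucl n) → ℝ} (v : Fin d → Eucl n)
    {L : Eucl n →L[ℝ] Eucl n} (hh : DifferentiableAt ℝ h fun i => L (v i)) :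
    HasFDerivAt (fun L : Eucl n →L[ℝ] Eucl n => h fun i => L (v i))
      ((fderiv ℝ h fun i => L (v i)) ∘L
        ContinuousLinearMap.pi fun i => ContinuousLinearMap.apply ℝ (Eucl n) (v i)) L :=
  HasFDerivAt.comp (f := fun (L : Eucl n →L[ℝ] Eucl n) (i : Fin d) => L (v i)) L hh.hasFDerivAt
    (ContinuousLinearMap.pi fun i => ContinuousLinearMap.apply ℝ (Eucl n) (v i)).hasFDerivAt

lemma norm_pi_apply_le (v : OrthoFrame d n) :
    ‖(ContinuousLinearMap.pi fun i => ContinuousLinearMap.apply ℝ (Eucl n) (v.1 i) :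
      (Eucl n →L[ℝ] Eucl n) →L[ℝ] Fin d → Eucl n)‖ ≤ 1 := by
  refine ContinuousLinearMap.opNorm_le_bound _ zero_le_one fun L => ?_
  rw [one_mul, pi_norm_le_iff_of_nonneg (norm_nonneg _)]
  intro i
  simpa [v.2.1 i] using L.le_opNorm (v.1 i)

lemma IsC1Integrand.differentiableAt_frameDensity {Ψ : Gr d n → ℝ} (hΨ : IsC1Integrand Ψ)
    {w : Fin d → Eucl n} (hw : LinearIndependent ℝ w) :
    DifferentiableAt ℝ (frameDensity Ψ) w :=
  (hΨ.contDiffOn_frameDensity.contDiffAt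
    (isOpen_setOfPred_linearIndependent.mem_nhds hw)).differentiableAt one_ne_zero

lemma linearIndependent_comp_frame {L : Eucl n →L[ℝ] Eucl n} (hL : Function.Injective L)
    (v : OrthoFrame d n) : LinearIndependent ℝ fun i => L (v.1 i) :=
  v.2.linearIndependent.map' L.toLinearMap (LinearMap.ker_eq_bot.2 hL)

/-- The radius `1/2` keeps every `L` injective. The frames `L v`, with `v` orthonormal, then form a
compact set of independent frames on which the derivative of `frameDensity` is bounded. The mean
value inequality on the convex ball gives a constant independent of `T`. -/
lemma IsC1Integrand.exists_lipschitzOnWith {Ψ : Gr d n → ℝ} (hΨ : IsC1Integrand Ψ) :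
    ∃ C : ℝ≥0, ∀ T, LipschitzOnWith C (fun L => imageDensity Ψ L T)
      (Metric.closedBall 1 (1 / 2)) := by
  have : ProperSpace (Eucl n →L[ℝ] Eucl n) := FiniteDimensional.proper_real _
  have hinj : ∀ L ∈ Metric.closedBall (1 : Eucl n →L[ℝ] Eucl n) (1 / 2),
      Function.Injective L := fun L hL =>
    injective_of_norm_sub_one_le (by rwa [← mem_closedBall_iff_norm])
  have hcont : Continuous fun p : (Eucl n →L[ℝ] Eucl n) × OrthoFrame d n =>
      fun i => p.1 (p.2.1 i) :=
    continuous_pi fun i => continuous_fst.clm_apply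
      ((continuous_apply i).comp (continuous_subtype_val.comp continuous_snd))
  have hQ : IsCompact ((fun p : (Eucl n →L[ℝ] Eucl n) × OrthoFrame d n =>
      fun i => p.1 (p.2.1 i)) '' (Metric.closedBall 1 (1 / 2) ×ˢ univ)) :=
    ((isCompact_closedBall _ _).prod isCompact_univ).image hcont
  have hfd : ContinuousOn (fderiv ℝ (frameDensity Ψ)) {w | LinearIndependent ℝ w} :=
    hΨ.contDiffOn_frameDensity.continuousOn_fderiv_of_isOpen
      isOpen_setOfPred_linearIndependent le_rfl
  obtain ⟨C, hC⟩ := hQ.exists_bound_of_continuousOn (f := fderiv ℝ (frameDensity Ψ))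
    (hfd.mono (by
      rintro _ ⟨⟨L, v⟩, ⟨hL, -⟩, rfl⟩
      exact linearIndependent_comp_frame (hinj L hL) v))
  refine ⟨C.toNNReal, fun T => ?_⟩
  obtain ⟨v, rfl⟩ := OrthoFrame.surjective_plane T
  have hlip : LipschitzOnWith C.toNNReal
      (fun L : Eucl n →L[ℝ] Eucl n => frameDensity Ψ fun i => L (v.1 i))
      (Metric.closedBall 1 (1 / 2)) := by
    refine Convex.lipschitzOnWith_of_nnnorm_hasFDerivWithin_le
      (fun L hL => (hasFDerivAt_comp_frame v.1 (hΨ.differentiableAt_frameDensity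
        (linearIndependent_comp_frame (hinj L hL) v))).hasFDerivWithinAt) (fun L hL => ?_)
      (convex_closedBall (1 : Eucl n →L[ℝ] Eucl n) (1 / 2))
    rw [← NNReal.coe_le_coe, coe_nnnorm]
    refine ((ContinuousLinearMap.opNorm_comp_le _ _).trans ?_).trans (Real.le_coe_toNNReal C)
    calc _ ≤ ‖fderiv ℝ (frameDensity Ψ) fun i => L (v.1 i)‖ * 1 := by
          gcongr
          exact norm_pi_apply_le v
      _ ≤ C := by
          rw [mul_one]
          exact hC _ ⟨(L, v), ⟨hL, mem_univ _⟩, rfl⟩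
  intro L hL L' hL'
  simp only [imageDensity_plane Ψ (hinj L hL) v, imageDensity_plane Ψ (hinj L' hL') v]
  exact hlip hL hL'

lemma IsC1Integrand.differentiableAt_imageDensity {Ψ : Gr d n → ℝ} (hΨ : IsC1Integrand Ψ)
    (T : Gr d n) : DifferentiableAt ℝ (fun L => imageDensity Ψ L T) 1 := by
  obtain ⟨v, rfl⟩ := OrthoFrame.surjective_plane T
  have h1 : (fun L => imageDensity Ψ L v.plane) =ᶠ[𝓝 1]
      fun L => frameDensity Ψ fun i => L (v.1 i) := by
    filter_upwards [Metric.closedBall_mem_nhds (1 : Eucl n →L[ℝ] Eucl n) one_half_pos] with L hL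
    exact imageDensity_plane Ψ
      (injective_of_norm_sub_one_le (by rwa [← mem_closedBall_iff_norm])) v
  refine DifferentiableAt.congr_of_eventuallyEq ?_ h1
  exact (hasFDerivAt_comp_frame v.1 (hΨ.differentiableAt_frameDensity
    (linearIndependent_comp_frame Function.injective_id v))).differentiableAt

lemma LipDiffeo.continuous_imageDensity {Ψ : Gr d n → ℝ} (hΨ : Continuous Ψ) (f : LipDiffeo n) :
    Continuous fun p : Eucl n × Gr d n => imageDensity Ψ (f.deriv p.1) p.2 := by
  have h1 : Continuous fun p : Eucl n × Gr d n => planeJacobian (f.deriv p.1) p.2 :=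
    Continuous.comp (f := fun p : Eucl n × Gr d n => (f.deriv p.1, p.2))
      continuous_planeJacobian ((f.continuous_deriv.comp continuous_fst).prodMk continuous_snd)
  exact h1.mul (hΨ.comp (continuous_Gr_map f.continuous_deriv f.injective_deriv))

lemma LipDiffeo.ofReal_imageDensity (Ψ : Gr d n → ℝ) (f : LipDiffeo n) (p : Eucl n × Gr d n) :
    ENNReal.ofReal (imageDensity Ψ (f.deriv p.1) p.2) =
      ENNReal.ofReal (planeJacobian (f.deriv p.1) p.2) *
        ENNReal.ofReal (Ψ (Gr.map (f.deriv p.1) p.2)) :=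
  ENNReal.ofReal_mul (planeJacobian_nonneg _ _)

lemma varifoldEnergy_varifoldImage {Ψ : Gr d n → ℝ} (hΨ : Continuous Ψ) (f : LipDiffeo n)
    (V : Measure (Eucl n × Gr d n)) :
    varifoldEnergy Ψ (varifoldImage f.toHomeomorph V) =
      ∫⁻ p, ENNReal.ofReal (imageDensity Ψ (f.deriv p.1) p.2) ∂V := by
  have h1 : Measurable fun p : Eucl n × Gr d n =>
      (f.toHomeomorph p.1, Gr.map (f.deriv p.1) p.2) :=
    ((f.toHomeomorph.continuous.comp continuous_fst).prodMk
      (continuous_Gr_map f.continuous_deriv f.injective_deriv)).measurable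
  have h2 : Measurable fun p : Eucl n × Gr d n => ENNReal.ofReal (Ψ p.2) :=
    (ENNReal.continuous_ofReal.comp (hΨ.comp continuous_snd)).measurable
  rw [varifoldEnergy, varifoldImage]
  refine (lintegral_map h2 h1).trans ?_
  refine (lintegral_withDensity_eq_lintegral_mul _ f.measurable_planeJacobian_deriv
    (h2.comp h1)).trans ?_
  refine lintegral_congr fun p => ?_
  rw [f.ofReal_imageDensity]
  rfl

lemma lintegral_toVarifold (A : RectifiableCurrent d n) {u : Eucl n × Gr d n → ℝ≥0∞}
    (hu : Measurable u) :
    ∫⁻ p, u p ∂A.toVarifold = ∫⁻ x in A.carrier, A.mult x * u (x, A.plane x) ∂μHE[d] := by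
  have h1 : AEMeasurable (fun x => (x, A.plane x)) (μHE[d].restrict A.carrier) :=
    aemeasurable_id.prodMk A.aemeasurable_plane
  have h2 : AEMeasurable (fun x => (A.mult x : ℝ≥0∞)) (μHE[d].restrict A.carrier) :=
    A.aemeasurable_mult.coe_nnreal_ennreal
  have h3 : AEMeasurable (fun x => (x, A.plane x)) A.massMeasure :=
    h1.mono_ac (withDensity_absolutelyContinuous _ _)
  refine (lintegral_map' hu.aemeasurable h3).trans ?_
  exact lintegral_withDensity_eq_lintegral_mul₀ h2 (hu.comp_aemeasurable h1)

/-- The energy of the deformed current is expressed through the varifold of the original one, with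
an integrand independent of `A`. Varifold convergence can therefore be applied to it. -/
lemma energy_push_eq_lintegral_toVarifold {Ψ : Gr d n → ℝ} (hΨ : Continuous Ψ) (f : LipDiffeo n)
    (A : RectifiableCurrent d n) :
    (f.push A).energy Ψ =
      ∫⁻ p, ENNReal.ofReal (imageDensity Ψ (f.deriv p.1) p.2) ∂A.toVarifold := by
  have h1 : Measurable fun p : Eucl n × Gr d n =>
      ENNReal.ofReal (imageDensity Ψ (f.deriv p.1) p.2) :=
    (ENNReal.continuous_ofReal.comp (f.continuous_imageDensity hΨ)).measurable
  rw [lintegral_toVarifold A h1, f.energy_push]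
  exact lintegral_congr fun x => congrArg _ (f.ofReal_imageDensity Ψ (x, A.plane x)).symm

lemma energy_eq_lintegral_toVarifold {Ψ : Gr d n → ℝ} (hΨ : Continuous Ψ)
    (A : RectifiableCurrent d n) :
    A.energy Ψ = ∫⁻ p, ENNReal.ofReal (Ψ p.2) ∂A.toVarifold := by
  have h1 : Measurable fun p : Eucl n × Gr d n => ENNReal.ofReal (Ψ p.2) :=
    (ENNReal.continuous_ofReal.comp (hΨ.comp continuous_snd)).measurable
  rw [lintegral_toVarifold A h1]
  rfl

instance (A : RectifiableCurrent d n) : IsFiniteMeasure A.toVarifold :=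
  inferInstanceAs (IsFiniteMeasure (A.massMeasure.map _))

end Density

/-! ### Stationarity of limits of minimizing sequences -/

section Limit

variable {d n : ℕ}

/-- Lower semicontinuity of the energy under varifold convergence. -/
lemma lintegral_le_of_varifoldTendsto {Ψ : Gr d n → ℝ} (hΨ : Continuous Ψ) (hpos : ∀ T, 0 ≤ Ψ T)
    {V : ℕ → Measure (Eucl n × Gr d n)} {W : Measure (Eucl n × Gr d n)}
    [∀ j, IsFiniteMeasure (V j)] [IsFiniteMeasureOnCompacts W]
    (hconv : VarifoldTendsto V W) {a : ℝ≥0∞}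
    (ha : Tendsto (fun j => ∫⁻ p, ENNReal.ofReal (Ψ p.2) ∂(V j)) atTop (𝓝 a)) :
    ∫⁻ p, ENNReal.ofReal (Ψ p.2) ∂W ≤ a := by
  -- A cutoff in the space variable alone suffices, the Grassmannian being compact. It is `1` for
  -- `‖x‖ ≤ R` and `0` for `‖x‖ ≥ R + 1`.
  set χ : ℕ → Eucl n × Gr d n → ℝ := fun R p => max 0 (min 1 (R + 1 - ‖p.1‖)) with hχ
  have hχ0 : ∀ R p, 0 ≤ χ R p := fun R p => le_max_left _ _
  have hχ1 : ∀ R p, χ R p ≤ 1 := fun R p => max_le zero_le_one (min_le_left _ _)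
  have hcont : ∀ R, Continuous fun p => χ R p * Ψ p.2 := fun R =>
    (continuous_const.max (continuous_const.min (continuous_const.sub
      continuous_fst.norm))).mul (hΨ.comp continuous_snd)
  have hsupp : ∀ R, HasCompactSupport fun p => χ R p * Ψ p.2 := by
    intro R
    refine HasCompactSupport.intro
      ((isCompact_closedBall (0 : Eucl n) (R + 1)).prod (isCompact_univ (X := Gr d n)))
      fun p hp => ?_
    have h1 : (R : ℝ) + 1 < ‖p.1‖ := by
      by_contra! h
      exact hp ⟨mem_closedBall_zero_iff.2 h, mem_univ _⟩
    have h2 : χ R p = 0 := max_eq_left ((min_le_right _ _).trans (by linarith))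
    rw [h2, zero_mul]
  have hnn : ∀ R p, 0 ≤ χ R p * Ψ p.2 := fun R p => mul_nonneg (hχ0 R p) (hpos p.2)
  have hR : ∀ R, ∫⁻ p, ENNReal.ofReal (χ R p * Ψ p.2) ∂W ≤ a := by
    intro R
    rw [← ofReal_integral_eq_lintegral_ofReal
      ((hcont R).integrable_of_hasCompactSupport (hsupp R)) (ae_of_all _ (hnn R))]
    refine le_of_tendsto_of_tendsto'
      ((ENNReal.continuous_ofReal.tendsto _).comp (hconv _ (hcont R) (hsupp R))) ha fun j => ?_
    rw [Function.comp_apply, ofReal_integral_eq_lintegral_ofReal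
      ((hcont R).integrable_of_hasCompactSupport (hsupp R)) (ae_of_all _ (hnn R))]
    refine lintegral_mono fun p => ENNReal.ofReal_le_ofReal ?_
    exact mul_le_of_le_one_left (hpos _) (hχ1 R p)
  have hlim : ∀ p : Eucl n × Gr d n,
      liminf (fun R => ENNReal.ofReal (χ R p * Ψ p.2)) atTop = ENNReal.ofReal (Ψ p.2) := by
    intro p
    refine (tendsto_const_nhds.congr' ?_).liminf_eq
    filter_upwards [eventually_ge_atTop ⌈‖p.1‖⌉₊] with R hR
    have h1 : ‖p.1‖ ≤ R := (Nat.le_ceil _).trans (by exact_mod_cast hR)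
    have h2 : χ R p = 1 := by
      simp only [hχ]
      rw [min_eq_left (by linarith), max_eq_right zero_le_one]
    rw [h2, one_mul]
  calc ∫⁻ p, ENNReal.ofReal (Ψ p.2) ∂W
      = ∫⁻ p, liminf (fun R => ENNReal.ofReal (χ R p * Ψ p.2)) atTop ∂W := by simp_rw [hlim]
    _ ≤ liminf (fun R => ∫⁻ p, ENNReal.ofReal (χ R p * Ψ p.2) ∂W) atTop :=
        lintegral_liminf_le fun R => (ENNReal.continuous_ofReal.comp (hcont R)).measurable
    _ ≤ a := liminf_le_of_frequently_le' (Frequently.of_forall hR)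

lemma IsC1Integrand.imageDensity_nonneg {Ψ : Gr d n → ℝ} (hΨ : IsC1Integrand Ψ)
    (L : Eucl n →L[ℝ] Eucl n) (T : Gr d n) : 0 ≤ imageDensity Ψ L T :=
  mul_nonneg (planeJacobian_nonneg _ _) (hΨ.pos _).le

lemma integrable_toVarifold_of_continuous {Ψ : Gr d n → ℝ} (hΨ : Continuous Ψ)
    (V : Measure (Eucl n × Gr d n)) [IsFiniteMeasure V] : Integrable (fun p => Ψ p.2) V := by
  obtain ⟨C, hC⟩ := (isCompact_univ (X := Gr d n)).exists_bound_of_continuousOn hΨ.continuousOn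
  exact Integrable.of_bound (hΨ.comp continuous_snd).aestronglyMeasurable C
    (ae_of_all _ fun p => hC p.2 (mem_univ _))

/-! ### Energy along the deformation by a vector field. -/

section VectorField

variable {g : Eucl n → Eucl n}

/-- The energy density along the deformation `id + ε g`. -/
def deformedDensity (Ψ : Gr d n → ℝ) (g : Eucl n → Eucl n) (ε : ℝ) (p : Eucl n × Gr d n) : ℝ :=
  imageDensity Ψ (1 + ε • fderiv ℝ g p.1) p.2

lemma deformedDensity_zero (Ψ : Gr d n → ℝ) (g : Eucl n → Eucl n) (p : Eucl n × Gr d n) :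
    deformedDensity Ψ g 0 p = Ψ p.2 := by
  rw [deformedDensity, zero_smul ℝ (fderiv ℝ g p.1), add_zero, imageDensity_one]

lemma deformedDensity_of_notMem_tsupport (Ψ : Gr d n → ℝ) {p : Eucl n × Gr d n}
    (hp : p.1 ∉ tsupport g) (ε : ℝ) : deformedDensity Ψ g ε p = Ψ p.2 := by
  have h : ε • fderiv ℝ g p.1 = 0 := by
    rw [fderiv_of_notMem_tsupport ℝ hp]
    exact smul_zero (A := Eucl n →L[ℝ] Eucl n) ε
  rw [deformedDensity, h, add_zero, imageDensity_one]

lemma exists_deformation (hg : ContDiff ℝ (⊤ : ℕ∞) g) {C : ℝ≥0} (hC : LipschitzWith C g) {ε : ℝ}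
    (hε : |ε| * C ≤ 1 / 2) (Ψ : Gr d n → ℝ) :
    ∃ f : LipDiffeo n, (⇑f.toHomeomorph = fun x => x + ε • g x) ∧
      ∀ p : Eucl n × Gr d n, imageDensity Ψ (f.deriv p.1) p.2 = deformedDensity Ψ g ε p := by
  obtain ⟨f, hf⟩ := exists_lipDiffeo hg hC hε
  refine ⟨f, hf, fun p => ?_⟩
  rw [deformedDensity, LipDiffeo.deriv, hf,
    (hasFDerivAt_id_add_smul (hg.differentiable (by simp)) ε p.1).fderiv]

lemma continuous_deformedDensity {Ψ : Gr d n → ℝ} (hΨ : IsC1Integrand Ψ)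
    (hg : ContDiff ℝ (⊤ : ℕ∞) g) {C : ℝ≥0} (hC : LipschitzWith C g) {ε : ℝ}
    (hε : |ε| * C ≤ 1 / 2) : Continuous (deformedDensity Ψ g ε) := by
  obtain ⟨f, -, hf⟩ := exists_deformation hg hC hε Ψ
  have h : deformedDensity Ψ g ε =
      fun p : Eucl n × Gr d n => imageDensity Ψ (f.deriv p.1) p.2 := funext fun p => (hf p).symm
  rw [h]
  exact f.continuous_imageDensity hΨ.continuous

/-- The difference is an admissible test function for varifold convergence, though `Ψ` alone need
not be. -/
lemma hasCompactSupport_deformedDensity_sub (Ψ : Gr d n → ℝ) (hgc : HasCompactSupport g) (ε : ℝ) :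
    HasCompactSupport fun p : Eucl n × Gr d n => deformedDensity Ψ g ε p - Ψ p.2 := by
  refine HasCompactSupport.intro (hgc.isCompact.prod (isCompact_univ (X := Gr d n)))
    fun p hp => ?_
  rw [deformedDensity_of_notMem_tsupport Ψ fun h => hp ⟨h, mem_univ _⟩, sub_self]

lemma integrable_deformedDensity {Ψ : Gr d n → ℝ} (hΨ : IsC1Integrand Ψ)
    (hg : ContDiff ℝ (⊤ : ℕ∞) g) (hgc : HasCompactSupport g) {C : ℝ≥0} (hC : LipschitzWith C g)
    {ε : ℝ} (hε : |ε| * C ≤ 1 / 2) {V : Measure (Eucl n × Gr d n)} [IsFiniteMeasureOnCompacts V]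
    (hV : Integrable (fun p => Ψ p.2) V) : Integrable (deformedDensity Ψ g ε) V := by
  have h1 := ((continuous_deformedDensity hΨ hg hC hε).sub
    (hΨ.continuous.comp continuous_snd)).integrable_of_hasCompactSupport (μ := V)
    (hasCompactSupport_deformedDensity_sub Ψ hgc ε)
  refine (h1.add hV).congr (ae_of_all _ fun p => ?_)
  exact sub_add_cancel _ _

/-- A minimizing sequence cannot be improved by a deformation off the boundary, in the limit. -/
lemma integral_le_integral_deformedDensity {k : ℕ} {Ψ : Gr (k + 1) n → ℝ} (hΨ : IsC1Integrand Ψ)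
    {S : Current k n} {A : ℕ → RectifiableCurrent (k + 1) n}
    (hA : ∀ j, boundary (A j).toCurrent = S)
    (hmin : Tendsto (fun j => (A j).energy Ψ) atTop (𝓝 (fillingEnergy Ψ S)))
    (hfin : fillingEnergy Ψ S ≠ ∞)
    {W : Measure (Eucl n × Gr (k + 1) n)} [IsFiniteMeasureOnCompacts W]
    (hconv : VarifoldTendsto (fun j => (A j).toVarifold) W)
    (hW : Integrable (fun p => Ψ p.2) W)
    (hg : ContDiff ℝ (⊤ : ℕ∞) g) (hgc : HasCompactSupport g)
    (hgS : tsupport g ⊆ (Distribution.dsupport S)ᶜ) {C : ℝ≥0} (hC : LipschitzWith C g)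
    {ε : ℝ} (hε : |ε| * C ≤ 1 / 2) :
    ∫ p, Ψ p.2 ∂W ≤ ∫ p, deformedDensity Ψ g ε p ∂W := by
  obtain ⟨f, hfg, hfd⟩ := exists_deformation hg hC hε Ψ
  have hint : ∀ j, Integrable (fun p => Ψ p.2) (A j).toVarifold := fun j =>
    integrable_toVarifold_of_continuous hΨ.continuous _
  have hintε : ∀ j, Integrable (deformedDensity Ψ g ε) (A j).toVarifold := fun j =>
    integrable_deformedDensity hΨ hg hgc hC hε (hint j)
  have henergy : ∀ j, ((A j).energy Ψ).toReal = ∫ p, Ψ p.2 ∂(A j).toVarifold := by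
    intro j
    rw [energy_eq_lintegral_toVarifold hΨ.continuous, ← ofReal_integral_eq_lintegral_ofReal (hint j)
      (ae_of_all _ fun p => (hΨ.pos _).le), ENNReal.toReal_ofReal]
    exact integral_nonneg fun p => (hΨ.pos _).le
  have hle : ∀ j, (fillingEnergy Ψ S).toReal ≤ ∫ p, deformedDensity Ψ g ε p ∂(A j).toVarifold := by
    intro j
    have h1 : fillingEnergy Ψ S ≤ (f.push (A j)).energy Ψ := by
      refine iInf₂_le (f.push (A j))
        (f.boundary_push_eq (A j) (hA j) (isClosed_tsupport g) hgS fun x hx => ?_)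
      simp [hfg, image_eq_zero_of_notMem_tsupport hx]
    rw [energy_push_eq_lintegral_toVarifold hΨ.continuous] at h1
    simp only [hfd] at h1
    rw [← ofReal_integral_eq_lintegral_ofReal (hintε j)
      (ae_of_all _ fun p => hΨ.imageDensity_nonneg _ _)] at h1
    refine (ENNReal.toReal_mono ENNReal.ofReal_ne_top h1).trans_eq (ENNReal.toReal_ofReal ?_)
    exact integral_nonneg fun p => hΨ.imageDensity_nonneg _ _
  have hlim1 : Tendsto (fun j => ∫ p, Ψ p.2 ∂(A j).toVarifold) atTop
      (𝓝 (fillingEnergy Ψ S).toReal) := by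
    simp_rw [← henergy]
    exact (ENNReal.tendsto_toReal hfin).comp hmin
  have hlim2 := hconv _ ((continuous_deformedDensity hΨ hg hC hε).sub
    (hΨ.continuous.comp continuous_snd)) (hasCompactSupport_deformedDensity_sub Ψ hgc ε)
  -- The limit contains the filling energy and not `∫ Ψ dW`, which may be smaller if mass escapes to
  -- infinity. The filling energy cancels against the lower bound `hle`.
  have hlim3 : Tendsto (fun j => ∫ p, deformedDensity Ψ g ε p ∂(A j).toVarifold) atTop
      (𝓝 (∫ p, (deformedDensity Ψ g ε p - Ψ p.2) ∂W + (fillingEnergy Ψ S).toReal)) := by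
    refine (hlim2.add hlim1).congr fun j => ?_
    have h2 := integral_sub (hintε j) (hint j)
    change ∫ p, (deformedDensity Ψ g ε p - Ψ p.2) ∂(A j).toVarifold + _ = _
    rw [h2, sub_add_cancel]
  have hfinal := ge_of_tendsto' hlim3 hle
  rw [integral_sub (integrable_deformedDensity hΨ hg hgc hC hε hW) hW] at hfinal
  linarith

lemma hasDerivAt_deformedDensity {Ψ : Gr d n → ℝ} (hΨ : IsC1Integrand Ψ) (g : Eucl n → Eucl n)
    (p : Eucl n × Gr d n) :
    HasDerivAt (fun ε => deformedDensity Ψ g ε p)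
      (fderiv ℝ (fun L => imageDensity Ψ L p.2) 1 (fderiv ℝ g p.1)) 0 := by
  have h1 : HasDerivAt (fun ε : ℝ => (1 : Eucl n →L[ℝ] Eucl n) + ε • fderiv ℝ g p.1)
      (fderiv ℝ g p.1) 0 := by
    simpa using ((hasDerivAt_id (0 : ℝ)).smul_const (fderiv ℝ g p.1)).const_add 1
  have h2 : HasFDerivAt (fun L => imageDensity Ψ L p.2)
      (fderiv ℝ (fun L => imageDensity Ψ L p.2) 1)
      ((1 : Eucl n →L[ℝ] Eucl n) + (0 : ℝ) • fderiv ℝ g p.1) := by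
    rw [zero_smul ℝ (fderiv ℝ g p.1), add_zero]
    exact (hΨ.differentiableAt_imageDensity p.2).hasFDerivAt
  exact h2.comp_hasDerivAt 0 h1

/-- The Lipschitz constant in `ε` is proportional to `‖Dg‖`. For compactly supported smooth `g` it
is integrable for any measure finite on compact sets, and so serves as the dominating function. -/
lemma exists_lipschitzOnWith_deformedDensity {Ψ : Gr d n → ℝ} (hΨ : IsC1Integrand Ψ) {C : ℝ≥0}
    (hC : LipschitzWith C g) {r : ℝ} (hr : r * C ≤ 1 / 2) :
    ∃ B : ℝ≥0, ∀ p : Eucl n × Gr d n,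
      LipschitzOnWith (B * ‖fderiv ℝ g p.1‖₊) (fun ε => deformedDensity Ψ g ε p)
        (Metric.closedBall 0 r) := by
  obtain ⟨B, hB⟩ := hΨ.exists_lipschitzOnWith
  refine ⟨B, fun p => LipschitzOnWith.comp (g := fun L => imageDensity Ψ L p.2)
    (f := fun ε : ℝ => (1 : Eucl n →L[ℝ] Eucl n) + ε • fderiv ℝ g p.1) (hB p.2) ?_ ?_⟩
  · refine LipschitzWith.lipschitzOnWith (LipschitzWith.of_dist_le_mul fun ε ε' => ?_)
    rw [dist_eq_norm, add_sub_add_left_eq_sub, ← sub_smul ε ε' (fderiv ℝ g p.1),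
      norm_smul, mul_comm]
    rfl
  · intro ε hε
    rw [mem_closedBall_iff_norm, add_sub_cancel_left, norm_smul]
    rw [mem_closedBall_zero_iff] at hε
    calc ‖ε‖ * ‖fderiv ℝ g p.1‖ ≤ r * C := by
          gcongr
          · exact (norm_nonneg _).trans hε
          · exact norm_fderiv_le_of_lipschitz ℝ hC
      _ ≤ 1 / 2 := hr

lemma exists_hasDerivAt_integral_deformedDensity {Ψ : Gr d n → ℝ} (hΨ : IsC1Integrand Ψ)
    (hg : ContDiff ℝ (⊤ : ℕ∞) g) (hgc : HasCompactSupport g) {C : ℝ≥0} (hC : LipschitzWith C g)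
    {W : Measure (Eucl n × Gr d n)} [IsFiniteMeasureOnCompacts W]
    (hW : Integrable (fun p => Ψ p.2) W) :
    ∃ c, HasDerivAt (fun ε => ∫ p, deformedDensity Ψ g ε p ∂W) c 0 := by
  set r : ℝ := 1 / (2 * (C + 1)) with hr
  have hr0 : 0 < r := by positivity
  have hrC : r * C ≤ 1 / 2 := by
    rw [hr, div_mul_eq_mul_div, div_le_div_iff₀ (by positivity) two_pos]
    linarith [C.coe_nonneg]
  have hsmall : ∀ ε ∈ Metric.closedBall (0 : ℝ) r, |ε| * C ≤ 1 / 2 := by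
    intro ε hε
    rw [mem_closedBall_zero_iff, Real.norm_eq_abs] at hε
    exact (mul_le_mul_of_nonneg_right hε C.coe_nonneg).trans hrC
  obtain ⟨B, hB⟩ := exists_lipschitzOnWith_deformedDensity (d := d) hΨ hC hrC
  have hfd : Continuous (fderiv ℝ g) := hg.continuous_fderiv (by simp)
  have hmeas : ∀ ε ∈ Metric.closedBall (0 : ℝ) r,
      AEStronglyMeasurable (deformedDensity Ψ g ε) W := fun ε hε =>
    (continuous_deformedDensity hΨ hg hC (hsmall ε hε)).aestronglyMeasurable
  have hnhds : Metric.closedBall (0 : ℝ) r ∈ 𝓝 0 := Metric.closedBall_mem_nhds _ hr0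
  have hbound : Integrable (fun p : Eucl n × Gr d n => (B : ℝ) * ‖fderiv ℝ g p.1‖) W := by
    refine Continuous.integrable_of_hasCompactSupport
      (continuous_const.mul (hfd.comp continuous_fst).norm) ?_
    refine HasCompactSupport.intro (hgc.isCompact.prod (isCompact_univ (X := Gr d n)))
      fun p hp => ?_
    rw [fderiv_of_notMem_tsupport ℝ fun h => hp ⟨h, mem_univ _⟩, norm_zero, mul_zero]
  -- Measurability of the derivative in `p` comes from its being a pointwise limit of difference
  -- quotients along `r / (k + 1)`; no regularity in `T` has to be shown.
  have hF' : AEStronglyMeasurable (fun p : Eucl n × Gr d n =>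
      fderiv ℝ (fun L => imageDensity Ψ L p.2) 1 (fderiv ℝ g p.1)) W := by
    have hseq : Tendsto (fun k : ℕ => r * (1 / ((k : ℝ) + 1))) atTop (𝓝[≠] 0) := by
      refine tendsto_nhdsWithin_iff.2 ⟨?_, Eventually.of_forall fun k => ?_⟩
      · simpa using tendsto_one_div_add_atTop_nhds_zero_nat.const_mul r
      · have : 0 < r * (1 / ((k : ℝ) + 1)) := by positivity
        exact this.ne'
    have hmem : ∀ k : ℕ, r * (1 / ((k : ℝ) + 1)) ∈ Metric.closedBall (0 : ℝ) r := by
      intro k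
      rw [mem_closedBall_zero_iff, Real.norm_of_nonneg (by positivity)]
      refine mul_le_of_le_one_right hr0.le ?_
      rw [div_le_one (by positivity)]
      linarith [(Nat.cast_nonneg k : (0 : ℝ) ≤ k)]
    refine aestronglyMeasurable_of_tendsto_ae atTop
      (f := fun (k : ℕ) p => (r * (1 / ((k : ℝ) + 1)))⁻¹ •
        (deformedDensity Ψ g (r * (1 / ((k : ℝ) + 1))) p - deformedDensity Ψ g 0 p))
      (fun k => ((hmeas _ (hmem k)).sub (hmeas 0 (by simp [hr0.le]))).fun_const_smul _)
      (ae_of_all _ fun p => ?_)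
    have h1 := (hasDerivAt_iff_tendsto_slope_zero.1 (hasDerivAt_deformedDensity hΨ g p)).comp hseq
    simpa only [Function.comp_def, zero_add] using h1
  refine ⟨_, (hasDerivAt_integral_of_dominated_loc_of_lip
    (bound := fun p : Eucl n × Gr d n => (B : ℝ) * ‖fderiv ℝ g p.1‖) hnhds
    (by filter_upwards [hnhds] with ε hε using hmeas ε hε)
    (hW.congr (ae_of_all _ fun p => (deformedDensity_zero Ψ g p).symm)) hF'
    (ae_of_all _ fun p => ?_) hbound
    (ae_of_all _ fun p => hasDerivAt_deformedDensity hΨ g p)).2⟩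
  have h1 : Real.nnabs ((B : ℝ) * ‖fderiv ℝ g p.1‖) = B * ‖fderiv ℝ g p.1‖₊ := by
    ext
    simp
  rw [h1]
  exact hB p

end VectorField

end Limit

/-- The limit of the varifolds of a sequence of rectifiable currents that minimizes the energy among
the fillings of `S` is stationary away from the support of `S`. -/
theorem isStationaryIn_of_minimizing {k n : ℕ}
    (Ψ : Gr (k + 1) n → ℝ) (hΨ : IsC1Integrand Ψ)
    (S : Current k n)
    (A : ℕ → RectifiableCurrent (k + 1) n)
    (hA : ∀ j, boundary (A j).toCurrent = S)
    (hmin : Tendsto (fun j => (A j).energy Ψ) atTop (𝓝 (fillingEnergy Ψ S)))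
    (W : Measure (Eucl n × Gr (k + 1) n)) (hW : IsFiniteMeasureOnCompacts W)
    (hconv : VarifoldTendsto (fun j => (A j).toVarifold) W) :
    IsStationaryIn Ψ W (Distribution.dsupport S)ᶜ := by
  have hcont := hΨ.continuous
  have hfin : fillingEnergy Ψ S ≠ ∞ := by
    refine ((iInf₂_le (A 0) (hA 0)).trans_lt ?_).ne
    rw [energy_eq_lintegral_toVarifold hcont, ← ofReal_integral_eq_lintegral_ofReal
      (integrable_toVarifold_of_continuous hcont _) (ae_of_all _ fun p => (hΨ.pos _).le)]
    exact ENNReal.ofReal_lt_top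
  -- Lower semicontinuity makes `Ψ` integrable for `W`, which is a priori only finite on compact
  -- sets.
  have hlsc : ∫⁻ p, ENNReal.ofReal (Ψ p.2) ∂W ≤ fillingEnergy Ψ S := by
    refine lintegral_le_of_varifoldTendsto hcont (fun T => (hΨ.pos T).le) hconv ?_
    simpa only [← energy_eq_lintegral_toVarifold hcont] using hmin
  have hWint : Integrable (fun p : Eucl n × Gr (k + 1) n => Ψ p.2) W :=
    (lintegral_ofReal_ne_top_iff_integrable (hcont.comp continuous_snd).aestronglyMeasurable
      (ae_of_all _ fun p => (hΨ.pos _).le)).1 (hlsc.trans_lt hfin.lt_top).ne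
  intro g hg hgc hgS
  obtain ⟨C, hC⟩ := hg.lipschitzWith_of_hasCompactSupport hgc (by simp)
  have hsmall : ∀ᶠ ε : ℝ in 𝓝 0, |ε| * C ≤ 1 / 2 := by
    have h : Tendsto (fun ε : ℝ => |ε| * C) (𝓝 0) (𝓝 0) := by
      have h' : Continuous fun ε : ℝ => |ε| * C := by fun_prop
      simpa using h'.tendsto 0
    exact h.eventually_le_const one_half_pos
  -- For small `ε` the `ENNReal` energy is a Bochner integral. This gives finiteness and moves the
  -- derivative to a real-valued function.
  have hval : ∀ᶠ ε : ℝ in 𝓝 0,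
      varifoldEnergy Ψ (varifoldImage (fun x => x + ε • g x) W) =
        ENNReal.ofReal (∫ p, deformedDensity Ψ g ε p ∂W) := by
    filter_upwards [hsmall] with ε hε
    obtain ⟨f, hfg, hfd⟩ := exists_deformation hg hC hε Ψ
    rw [ofReal_integral_eq_lintegral_ofReal (integrable_deformedDensity hΨ hg hgc hC hε hWint)
      (ae_of_all _ fun p => hΨ.imageDensity_nonneg _ _), ← hfg,
      varifoldEnergy_varifoldImage hcont]
    simp only [hfd]
  obtain ⟨c, hc⟩ := exists_hasDerivAt_integral_deformedDensity hΨ hg hgc hC hWint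
  have hmin0 : IsLocalMin (fun ε => ∫ p, deformedDensity Ψ g ε p ∂W) 0 := by
    filter_upwards [hsmall] with ε hε
    simp only [deformedDensity_zero]
    exact integral_le_integral_deformedDensity hΨ hA hmin hfin hconv hWint hg hgc hgS hC hε
  rw [hmin0.hasDerivAt_eq_zero hc] at hc
  refine ⟨hval.mono fun ε h => h ▸ ENNReal.ofReal_ne_top, hc.congr_of_eventuallyEq ?_⟩
  filter_upwards [hval] with ε h
  rw [h, ENNReal.toReal_ofReal]
  exact integral_nonneg fun p => hΨ.imageDensity_nonneg _ _

end Aniso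

theorem proposition4p1 {k n : ℕ} (hkn : k + 1 ≤ n)
    (Ψ : Aniso.Gr (k + 1) n → ℝ) (hΨ : Aniso.IsC1Integrand Ψ)
    (S : Aniso.Current k n) (hS : Aniso.IsIntegralCurrent S)
    (A : ℕ → Aniso.RectifiableCurrent (k + 1) n)
    (hA : ∀ j, Aniso.boundary (A j).toCurrent = S)
    (hmin : Tendsto (fun j => (A j).energy Ψ) atTop (𝓝 (Aniso.fillingEnergy Ψ S)))
    (W : Measure (Aniso.Eucl n × Aniso.Gr (k + 1) n)) (hW : IsFiniteMeasureOnCompacts W)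
    (hconv : Aniso.VarifoldTendsto (fun j => (A j).toVarifold) W) :
    Aniso.IsStationaryIn Ψ W (Distribution.dsupport S)ᶜ := by
  exact Aniso.isStationaryIn_of_minimizing Ψ hΨ S A hA hmin W hW hconv
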